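/- For real numbers $y_1,\dots,y_J$ let $\widehat{\mathrm{med}}(y_1,\dots,y_J)$ denote the sample median (the middle order statistic if $J$ is odd, the average of the two middle order statistics if $J$ is even). A median of a probability law $\mu$ on $\mathbb R$ is an $m$ with $\mu((-\infty,m])\ge \frac12$ and $\mu([m,\infty))\ge\frac12$. All probabilities, expectations and variances below are conditional on the given estimates $\hat{\boldsymbol\theta}=(\hat\theta_1,\dots,\hat\theta_n)$, which are regarded as fixed; $f'$ is the derivative of $f$; the $O(\cdot)$ are for $J\to\infty$ (over all $J$, odd and even), with constants that may depend on the law of $Y_1$. (a) Let $Y_1,Y_2,\dots$ be (conditionally) iid real random variables with finite variance and a unique median $m$, whose common law has a density $f$ with $f(m)>0$, and let $\hat\theta^{(J)}=\widehat{\mathrm{med}}(Y_1,\dots,Y_J)$. Then $\hat\theta^{(J)}$ has finite variance for every $J\ge1$ if $f$ is differentiable at $m$, and in that case $$\mathbb E[\hat\theta^{(J)}]=m+O\!\left(\tfrac1J\right),\qquad \mathbb V[\hat\theta^{(J)}]=O\!\left(\tfrac1J\right).$$ If moreover $f$ is three times continuously differentiable in a neighbourhood of $m$, then $$\mathbb E[\hat\theta^{(J)}]=m-\frac{f'(m)}{8J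 f(m)^3}+O\!\left(\tfrac1{J^2}\right),\qquad \mathbb V[\hat\theta^{(J)}]=\frac{1}{4J f(m)^2}+O\!\left(\tfrac1{J^2}\right).$$ (b) (Bayesian median of means.) Let $n\ge1$, $\alpha>0$, $\hat\theta_1,\dots,\hat\theta_n\in\mathbb R$ be fixed, let $\mathbf p^{(1)},\mathbf p^{(2)},\dots$ be iid with the Dirichlet distribution $\mathrm{Dir}_n(\alpha,\dots,\alpha)$, put $Y_j=\sum_{i=1}^n p^{(j)}_i\hat\theta_i$ and $\hat\theta_{\mathrm{BMM}}=\hat\theta_{\mathrm{BMM}}^{(J)}=\widehat{\mathrm{med}}(Y_1,\dots,Y_J)$. Suppose that the law of $Y_1$ has a unique median $m$ and that $m\ne\hat\theta_i$ for $i=1,\dots,n$. Then the law of $Y_1$ has a density $f$ which is three times continuously differentiable in a neighbourhood of $m$ and satisfies $f(m)>0$, $\hat\theta_{\mathrm{BMM}}$ has finite variance for every $J\ge1$, and $$\mathbb E[\hat\theta_{\mathrm{BMM}}]=m+O\!\left(\tfrac1J\right),\qquad \mathbb V[\hat\theta_{\mathrm{BMM}}]=O\!\left(\tfrac1J\right);$$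 more precisely, $$\mathbb E[\hat\theta_{\mathrm{BMM}}]=m-\frac{f'(m)}{8J f(m)^3}+O\!\left(\tfrac1{J^2}\right),\qquad \mathbb V[\hat\theta_{\mathrm{BMM}}]=\frac{1}{4J f(m)^2}+O\!\left(\tfrac1{J^2}\right).$$ -/

import Mathlib

open MeasureTheory ProbabilityTheory Filter Asymptotics
open scoped ENNReal

/-- The `k`-th smallest value (counting from `0`) among `y 0, …, y (J - 1)`. -/
noncomputable def orderStatistic {J : ℕ} (y : Fin J → ℝ) (k : Fin J) : ℝ :=
  y (Tuple.sort y k)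

/-- The sample median of `y 0, …, y (J - 1)`: the middle order statistic if `J` is odd, the average
of the two middle order statistics if `J` is even. (Value `0` for the empty sample.) -/
noncomputable def sampleMedian {J : ℕ} (y : Fin J → ℝ) : ℝ :=
  if h : 0 < J then
    (orderStatistic y ⟨(J - 1) / 2, by omega⟩ + orderStatistic y ⟨J / 2, by omega⟩) / 2
  else 0

/-- `m` is a median of the probability measure `μ` on the line. -/
def IsMedian (μ : Measure ℝ) (m : ℝ) : Prop :=
  1 / 2 ≤ μ (Set.Iic m) ∧ 1 / 2 ≤ μ (Set.Ici m)

/-- `m` is the one and only median of `μ`. -/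
def IsUniqueMedian (μ : Measure ℝ) (m : ℝ) : Prop :=
  IsMedian μ m ∧ ∀ m', IsMedian μ m' → m' = m

/-- `f` is a (version of the) probability density of the measure `μ` on the line. -/
def IsDensityOf (f : ℝ → ℝ) (μ : Measure ℝ) : Prop :=
  Measurable f ∧ (∀ y, 0 ≤ f y) ∧ μ = volume.withDensity (fun y => ENNReal.ofReal (f y))

/-- The Dirichlet distribution with parameters `α i > 0`, `i < n`: the law of
`(G₁ / S, …, Gₙ / S)`, where `G₁, …, Gₙ` are independent, `Gᵢ ~ Gamma(αᵢ, 1)` and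
`S = G₁ + ⋯ + Gₙ`. -/
noncomputable def dirichletMeasure {n : ℕ} (α : Fin n → ℝ) : Measure (Fin n → ℝ) :=
  (Measure.pi fun i => gammaMeasure (α i) 1).map (fun g i => g i / ∑ k, g k)

/-- The weighted mean `∑ᵢ pᵢ θᵢ` of the estimates `θ` with weights `p`. -/
noncomputable def weightedMean {n : ℕ} (θ p : Fin n → ℝ) : ℝ :=
  ∑ i, p i * θ i

/-- The sample median of the first `J` variables of the sequence `Y`. -/
noncomputable def medianEstimator {Ω : Type*} (Y : ℕ → Ω → ℝ) (J : ℕ) (ω : Ω) : ℝ :=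
  sampleMedian (fun j : Fin J => Y j ω)

/-- The bias of the estimators `T J` of `m` and their variance are `O(1/J)` under `P`;
in particular the `T J`, `J ≥ 1`, have a mean and a variance. -/
def FirstOrderBiasVariance {Ω : Type*} [MeasurableSpace Ω] (P : Measure Ω)
    (T : ℕ → Ω → ℝ) (m : ℝ) : Prop :=
  (∀ J : ℕ, 1 ≤ J → MemLp (T J) 2 P) ∧
  (fun J : ℕ => (∫ ω, T J ω ∂P) - m) =O[atTop] (fun J : ℕ => 1 / (J : ℝ)) ∧
  (fun J : ℕ => variance (T J) P) =O[atTop] (fun J : ℕ => 1 / (J : ℝ))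

/-- The bias of `T J` is `-f'(m) / (8 J f(m)³) + O(1/J²)` and its variance is
`1 / (4 J f(m)²) + O(1/J²)`. -/
def SecondOrderBiasVariance {Ω : Type*} [MeasurableSpace Ω] (P : Measure Ω)
    (T : ℕ → Ω → ℝ) (f : ℝ → ℝ) (m : ℝ) : Prop :=
  (fun J : ℕ => (∫ ω, T J ω ∂P) - (m - deriv f m / (8 * (J : ℝ) * f m ^ 3)))
    =O[atTop] (fun J : ℕ => 1 / (J : ℝ) ^ 2) ∧
  (fun J : ℕ => variance (T J) P - 1 / (4 * (J : ℝ) * f m ^ 2))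
    =O[atTop] (fun J : ℕ => 1 / (J : ℝ) ^ 2)

open scoped Topology

/-! For a law `μ` without atoms and with distribution function `F`, the variables `F (Y j)` are
uniform, and the `k`-th order statistic has density `orderDensity J k (F y)` with respect to `μ`
(`map_orderStatistic`). If `x = y - m` is expanded in powers of `v = F y - 1/2`, the mean of an
order statistic becomes a combination of the centred moments `orderMoment J k r` of a beta law.
These obey a three-term recursion (`orderMoment_recursion`): for a middle index the second moment is
`1/(4J) + O(1/J²)`, the third and fourth are `O(1/J²)`, and the first moments of the two middle
indices cancel. Taylor expansion of `F` at `m` gives `v = a x + b x² + c x³ + O(x⁴)` with `a = f m`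
and `b = f'(m)/2`, hence `x = v/a - b v²/a³ + ...`. The quadratic term yields the bias `-f'(m)/(8 J
a³)`, and `x² = v²/a² + ...` yields the variance `1/(4 J a²)`.

The expansion is only local. Away from `m` the error is dominated by `(y - m)²`, while the beta
density is `O(1/J²)` there (`orderDensity_tail`), so a finite second moment of `μ` suffices.

For even `J` the square of an average of two order statistics brings in the square of their gap. On
the scale of `F` this gap has mean square `O(1/J²)`, by a Fubini argument
(`lintegral_sq_spacing_le`).

For Dirichlet weights, `F t` is the probability that `∑ G i (θ i - t) ≤ 0` with independent gamma
variables `G i`. Rescaling `G i` by `|θ i - t|` fixes the event and moves `t` into the rates;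
exponential tilting then writes `F` as an elementary factor times an exponential integral, analytic
off the points `θ i`. Hence `F'` is a density, smooth at `m`. It is positive there because,
conditionally on the other variables, one gamma variable with `θ i > m` has a density bounded below
on the interval that moves the mean just past `m`. -/

/-! ### Order statistics and counting -/

theorem orderStatistic_le_iff {J : ℕ} (y : Fin J → ℝ) (k : Fin J) (t : ℝ) :
    orderStatistic y k ≤ t ↔ (k : ℕ) < (Finset.univ.filter fun j => y j ≤ t).card := by
  have h := Tuple.lt_card_le_iff_apply_le_of_monotone (j := k) (a := t) (Tuple.monotone_sort y)
  unfold orderStatistic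
  rw [← Function.comp_apply (f := y), ← h]
  -- Sorting permutes the sample, so it does not change how many values are at most `t`.
  have e : (Finset.univ.filter fun j => (y ∘ Tuple.sort y) j ≤ t).card
      = (Finset.univ.filter fun j => y j ≤ t).card := by
    refine Finset.card_bij (fun j _ => Tuple.sort y j) ?_ ?_ ?_
    · intro j hj; simpa using hj
    · intro a _ b _ hab; exact (Tuple.sort y).injective hab
    · intro b hb; exact ⟨(Tuple.sort y).symm b, by simpa using hb, by simp⟩
  rw [← e]

theorem measurable_card_filter_le {J : ℕ} (t : ℝ) :
    Measurable fun y : Fin J → ℝ => (Finset.univ.filter fun j => y j ≤ t).card := by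
  simp_rw [Finset.card_filter]
  refine Finset.measurable_sum _ fun j _ => ?_
  exact Measurable.ite (measurableSet_le (measurable_pi_apply j) measurable_const)
    measurable_const measurable_const

theorem measurable_orderStatistic {J : ℕ} (k : Fin J) :
    Measurable fun y : Fin J → ℝ => orderStatistic y k := by
  refine measurable_of_Iic fun t => ?_
  have : (fun y : Fin J → ℝ => orderStatistic y k) ⁻¹' Set.Iic t
      = {y | (k : ℕ) < (Finset.univ.filter fun j => y j ≤ t).card} := by
    ext y; simp [orderStatistic_le_iff]
  rw [this]
  exact measurableSet_lt measurable_const (measurable_card_filter_le t)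

theorem measurable_sampleMedian {J : ℕ} : Measurable fun y : Fin J → ℝ => sampleMedian y := by
  unfold sampleMedian
  split_ifs with h
  · exact ((measurable_orderStatistic _).add (measurable_orderStatistic _)).div_const 2
  · exact measurable_const

theorem orderStatistic_mono {J : ℕ} (y : Fin J → ℝ) : Monotone (orderStatistic y) :=
  Tuple.monotone_sort y

/-- The probability that exactly `i` of `J` independent variables of law `μ` lie in `A`, and the
others in `B`. -/
theorem measure_pi_card_eq {J : ℕ} (μ : Measure ℝ) [IsProbabilityMeasure μ] {A B : Set ℝ}
    [DecidablePred (· ∈ A)]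
    (hA : MeasurableSet A) (hB : MeasurableSet B) (hAB : Disjoint A B) (i : ℕ) :
    (Measure.pi fun _ : Fin J => μ)
      {y | (∀ j, y j ∈ A ∪ B) ∧ (Finset.univ.filter fun j => y j ∈ A).card = i}
      = (J.choose i : ℝ≥0∞) * μ A ^ i * μ B ^ (J - i) := by
  classical
  -- The event splits into disjoint boxes, one for each `i`-element set `S` of indices: `A` at the
  -- places in `S`, `B` elsewhere.
  have e : {y : Fin J → ℝ | (∀ j, y j ∈ A ∪ B) ∧ (Finset.univ.filter fun j => y j ∈ A).card = i}
      = ⋃ S ∈ Finset.powersetCard i (Finset.univ : Finset (Fin J)),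
        Set.univ.pi fun j => if j ∈ S then A else B := by
    ext y
    simp only [Set.mem_ofPred_eq, Set.mem_iUnion, Set.mem_pi, Set.mem_univ, true_imp_iff,
      Finset.mem_powersetCard, Finset.subset_univ, true_and, exists_prop]
    constructor
    · rintro ⟨h1, h2⟩
      refine ⟨_, h2, fun j => ?_⟩
      by_cases hj : y j ∈ A
      · simp [hj]
      · simpa [hj] using h1 j
    · rintro ⟨S, hS, h⟩
      have hm : ∀ j, y j ∈ A ↔ j ∈ S := fun j => by
        have := h j
        by_cases hj : j ∈ S
        · simp_all
        · simp only [hj, if_false] at this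
          simpa [hj] using fun h' => Set.disjoint_left.1 hAB h' this
      refine ⟨fun j => ?_, ?_⟩
      · have := h j
        split_ifs at this
        exacts [Or.inl this, Or.inr this]
      · simp_rw [hm]; simpa using hS
  have hm : ∀ S : Finset (Fin J), ∀ j, MeasurableSet (if j ∈ S then A else B) := fun S j => by
    split_ifs <;> assumption
  rw [e, measure_biUnion_finset]
  · have : ∀ S ∈ Finset.powersetCard i (Finset.univ : Finset (Fin J)),
        (Measure.pi fun _ : Fin J => μ) (Set.univ.pi fun j => if j ∈ S then A else B)
          = μ A ^ i * μ B ^ (J - i) := by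
      intro S hS
      rw [Measure.pi_pi]
      have hc := (Finset.mem_powersetCard.1 hS).2
      simp_rw [apply_ite μ]
      rw [Finset.prod_ite]
      simp only [Finset.prod_const]
      have h1 : (Finset.univ.filter (· ∈ S)) = S := by ext; simp
      have h2 : (Finset.univ.filter (· ∉ S)) = Sᶜ := by ext; simp
      rw [h1, h2, Finset.card_compl, hc, Fintype.card_fin]
    rw [Finset.sum_congr rfl this]
    simp [mul_assoc]
  · intro S _ T _ hST
    rw [Function.onFun, Set.disjoint_left]
    intro y hyS hyT
    apply hST
    ext j
    have h1 := hyS j trivial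
    have h2 := hyT j trivial
    by_cases hS : j ∈ S <;> by_cases hT : j ∈ T <;> simp only [hS, hT, if_true, if_false] at h1 h2 ⊢
    · exact absurd h2 (Set.disjoint_left.1 hAB h1)
    · exact absurd h1 (Set.disjoint_left.1 hAB h2)
  · exact fun S _ => MeasurableSet.univ_pi (hm S)

/-! ### The probability integral transform for a law without atoms -/

section UniformTransform
variable (μ : Measure ℝ) [IsProbabilityMeasure μ] [NullSingletonClass μ]

theorem continuous_cdf : Continuous (cdf μ) := by
  rw [continuous_iff_continuousAt]
  intro x
  rw [(cdf μ).mono.continuousAt_iff_leftLim_eq_rightLim, (cdf μ).rightLim_eq]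
  have h := (cdf μ).measure_singleton x
  rw [measure_cdf, measure_singleton] at h
  have h2 := (cdf μ).mono.leftLim_le (le_refl x)
  have := ENNReal.ofReal_eq_zero.1 h.symm
  linarith

/-- By continuity `F` attains every level in `(0, 1)`. If `F t = u`, the set contains `(-∞, t]`,
which gives the lower bound. Since `F` may be flat at level `u`, the upper bound compares with
points `t` at levels `v > u` and lets `v` decrease to `u`. -/
theorem cdf_measure_setOf_le {u : ℝ} (h0 : 0 ≤ u) (h1 : u ≤ 1) :
    μ {y | cdf μ y ≤ u} = ENNReal.ofReal u := by
  have key : ∀ u, 0 < u → u < 1 → ∃ t, cdf μ t = u := fun u h0 h1 => by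
    obtain ⟨a, ha⟩ := ((tendsto_cdf_atBot μ).eventually (gt_mem_nhds h0)).exists
    obtain ⟨b, hb⟩ := ((tendsto_cdf_atTop μ).eventually (lt_mem_nhds h1)).exists
    exact mem_range_of_exists_le_of_exists_ge (continuous_cdf μ) ⟨a, ha.le⟩ ⟨b, hb.le⟩
  have upper : ∀ u, 0 ≤ u → u < 1 → μ {y | cdf μ y ≤ u} ≤ ENNReal.ofReal u := by
    intro u h0 h1
    refine le_of_forall_gt_imp_ge_of_dense fun c hc => ?_
    rcases eq_or_ne c ⊤ with rfl | hct
    · exact le_top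
    have hc' : u < c.toReal := by
      rwa [← ENNReal.ofReal_lt_iff_lt_toReal h0 hct]
    obtain ⟨v, hv1, hv2⟩ := exists_between (lt_min hc' h1)
    obtain ⟨t, ht⟩ := key v (h0.trans_lt hv1) (hv2.trans_le (min_le_right _ _))
    calc μ {y | cdf μ y ≤ u} ≤ μ (Set.Iic t) := measure_mono fun y hy => by
          by_contra hyt
          have := monotone_cdf μ (not_le.1 hyt).le
          have hy' : cdf μ y ≤ u := hy
          linarith
      _ = ENNReal.ofReal v := by rw [← ofReal_cdf, ht]
      _ ≤ c := by
          rw [ENNReal.ofReal_le_iff_le_toReal hct]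
          exact (hv2.trans_le (min_le_left _ _)).le
  rcases h1.eq_or_lt with rfl | h1
  · have : {y | cdf μ y ≤ 1} = Set.univ := by ext y; simp [cdf_le_one]
    simp [this]
  refine le_antisymm (upper u h0 h1) ?_
  rcases h0.eq_or_lt with rfl | h0
  · simp
  obtain ⟨t, ht⟩ := key u h0 h1
  rw [← ht, ofReal_cdf]
  exact measure_mono fun y hy => monotone_cdf μ hy

/-- The probability integral transform. -/
theorem map_cdf : μ.map (cdf μ) = volume.restrict (Set.Icc 0 1) := by
  have : IsProbabilityMeasure (μ.map (cdf μ)) :=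
    Measure.isProbabilityMeasure_map (continuous_cdf μ).measurable.aemeasurable
  refine Measure.ext_of_Iic _ _ fun u => ?_
  rw [Measure.map_apply (continuous_cdf μ).measurable measurableSet_Iic,
    Measure.restrict_apply measurableSet_Iic]
  have e : (cdf μ) ⁻¹' Set.Iic u = {y | cdf μ y ≤ u} := rfl
  rw [e]
  rcases lt_or_ge u 0 with hu | hu
  · have h1 : {y | cdf μ y ≤ u} = ∅ := by
      ext y; simpa using hu.trans_le (cdf_nonneg μ y)
    have h2 : Set.Iic u ∩ Set.Icc 0 1 = ∅ := by
      ext y; simp only [Set.mem_inter_iff, Set.mem_Iic, Set.mem_Icc, Set.mem_empty_iff_false]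
      refine iff_of_false (fun h => ?_) id
      linarith [h.1, h.2.1]
    simp [h1, h2]
  rcases le_or_gt u 1 with hu1 | hu1
  · have h2 : Set.Iic u ∩ Set.Icc 0 1 = Set.Icc 0 u := by
      ext y; simp only [Set.mem_inter_iff, Set.mem_Iic, Set.mem_Icc]
      constructor
      · intro h; exact ⟨h.2.1, h.1⟩
      · intro h; exact ⟨h.2, h.1, h.2.trans hu1⟩
    rw [cdf_measure_setOf_le μ hu hu1, h2, Real.volume_Icc, sub_zero]
  · have h1 : {y | cdf μ y ≤ u} = Set.univ := by
      ext y; simpa using (cdf_le_one μ y).trans hu1.le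
    have h2 : Set.Iic u ∩ Set.Icc 0 1 = Set.Icc (0:ℝ) 1 := by
      ext y; simp only [Set.mem_inter_iff, Set.mem_Iic, Set.mem_Icc]
      constructor
      · intro h; exact h.2
      · intro h; exact ⟨h.2.trans hu1.le, h⟩
    simp [h1, h2]

/-- The two sets differ only by a flat stretch of `F`, which carries no mass. -/
theorem setOf_cdf_le_ae_eq (t : ℝ) : {y | cdf μ y ≤ cdf μ t} =ᵐ[μ] Set.Iic t := by
  have h : μ {y | cdf μ y ≤ cdf μ t} ≤ μ (Set.Iic t) := by
    rw [cdf_measure_setOf_le μ (cdf_nonneg μ t) (cdf_le_one μ t), ofReal_cdf]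
  exact (ae_eq_of_subset_of_measure_ge (fun y hy => monotone_cdf μ hy) h
    measurableSet_Iic.nullMeasurableSet (measure_ne_top _ _)).symm

theorem lintegral_comp_cdf {g : ℝ → ℝ≥0∞} (hg : Measurable g) :
    ∫⁻ y, g (cdf μ y) ∂μ = ∫⁻ u in Set.Icc 0 1, g u := by
  rw [← map_cdf μ, lintegral_map hg (continuous_cdf μ).measurable]

theorem setLIntegral_Iic_comp_cdf {g : ℝ → ℝ≥0∞} (hg : Measurable g) (t : ℝ) :
    ∫⁻ y in Set.Iic t, g (cdf μ y) ∂μ = ∫⁻ u in Set.Icc 0 (cdf μ t), g u := by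
  rw [← setLIntegral_congr (setOf_cdf_le_ae_eq μ t)]
  have e : {y | cdf μ y ≤ cdf μ t} = cdf μ ⁻¹' Set.Iic (cdf μ t) := rfl
  rw [e, ← setLIntegral_map measurableSet_Iic hg (continuous_cdf μ).measurable, map_cdf,
    Measure.restrict_restrict measurableSet_Iic]
  congr 2
  ext y; simp only [Set.mem_inter_iff, Set.mem_Iic, Set.mem_Icc]
  have := cdf_le_one μ t
  constructor
  · intro h; exact ⟨h.2.1, h.1⟩
  · intro h; exact ⟨h.2, h.1, h.2.trans this⟩

theorem integral_comp_cdf (g : ℝ → ℝ) (hg : Continuous g) :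
    ∫ y, g (cdf μ y) ∂μ = ∫ u in (0:ℝ)..1, g u := by
  rw [intervalIntegral.integral_of_le zero_le_one, ← integral_Icc_eq_integral_Ioc, ← map_cdf μ,
    integral_map (continuous_cdf μ).measurable.aemeasurable hg.aestronglyMeasurable]

end UniformTransform

/-! ### Law and centred moments of uniform order statistics -/

/-- The density of the `k`-th order statistic of `J` independent uniform variables. -/
noncomputable def orderDensity (J k : ℕ) (u : ℝ) : ℝ :=
  J * (bernsteinPolynomial ℝ (J - 1) k).eval u

theorem orderDensity_eq (J k : ℕ) (u : ℝ) :
    orderDensity J k u = (J * (J - 1).choose k) * (u ^ k * (1 - u) ^ (J - 1 - k)) := by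
  simp [orderDensity, bernsteinPolynomial]
  ring

theorem continuous_orderDensity (J k : ℕ) : Continuous (orderDensity J k) :=
  continuous_const.mul (Polynomial.continuous _)

theorem orderDensity_nonneg {J k : ℕ} {u : ℝ} (h0 : 0 ≤ u) (h1 : u ≤ 1) :
    0 ≤ orderDensity J k u := by
  rw [orderDensity_eq]
  have := sub_nonneg.2 h1
  positivity

/-- The derivative of the Bernstein polynomial of index `i` is `J` times a difference of two
consecutive ones of degree `J - 1`, so the derivative of the sum telescopes to `orderDensity`. The
sum is the probability that at least `k + 1` of `J` uniform points lie below `u`. -/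
theorem integral_orderDensity {J k : ℕ} (hk : k < J) (u : ℝ) :
    ∫ x in (0:ℝ)..u, orderDensity J k x
      = ∑ i ∈ Finset.Icc (k + 1) J, (bernsteinPolynomial ℝ J i).eval u := by
  have hd : ∀ x, HasDerivAt
      (fun x => ∑ i ∈ Finset.Icc (k + 1) J, (bernsteinPolynomial ℝ J i).eval x)
      (orderDensity J k x) x := by
    intro x
    have h := HasDerivAt.fun_sum (u := Finset.Icc (k + 1) J) (x := x)
      (A := fun i x => (bernsteinPolynomial ℝ J i).eval x) fun i _ =>
        (bernsteinPolynomial ℝ J i).hasDerivAt x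
    refine h.congr_deriv ?_
    have tel : ∀ L, k ≤ L → ∑ i ∈ Finset.Icc (k + 1) L,
        (Polynomial.derivative (bernsteinPolynomial ℝ J i)).eval x
        = J * ((bernsteinPolynomial ℝ (J - 1) k).eval x
          - (bernsteinPolynomial ℝ (J - 1) L).eval x) := by
      intro L hL
      induction L, hL using Nat.le_induction with
      | base => simp
      | succ L hL ih =>
        rw [Finset.sum_Icc_succ_top (by omega), ih, bernsteinPolynomial.derivative_succ]
        simp
        ring
    rw [tel J hk.le, bernsteinPolynomial.eq_zero_of_lt ℝ (show J - 1 < J by omega)]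
    simp [orderDensity]
  rw [intervalIntegral.integral_eq_sub_of_hasDerivAt (fun x _ => hd x)
    ((continuous_orderDensity J k).intervalIntegrable _ _)]
  have : ∑ i ∈ Finset.Icc (k + 1) J, (bernsteinPolynomial ℝ J i).eval 0 = 0 := by
    refine Finset.sum_eq_zero fun i hi => ?_
    rw [bernsteinPolynomial.eval_at_0, if_neg]
    have := (Finset.mem_Icc.1 hi).1
    omega
  rw [this, sub_zero]

theorem integral_orderDensity_one {J k : ℕ} (hk : k < J) :
    ∫ x in (0:ℝ)..1, orderDensity J k x = 1 := by
  rw [integral_orderDensity hk, Finset.sum_eq_single J]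
  · simp [bernsteinPolynomial.eval_at_1]
  · intro i _ hi
    simp [bernsteinPolynomial.eval_at_1, hi]
  · intro h
    exact absurd (Finset.mem_Icc.2 ⟨hk, le_rfl⟩) h

theorem measure_card_filter_le_eq (μ : Measure ℝ) [IsProbabilityMeasure μ] (J i : ℕ) (t : ℝ) :
    (Measure.pi fun _ : Fin J => μ) {y | (Finset.univ.filter fun j => y j ≤ t).card = i}
      = ENNReal.ofReal ((bernsteinPolynomial ℝ J i).eval (cdf μ t)) := by
  have h := measure_pi_card_eq (J := J) μ (measurableSet_Iic (a := t)) (measurableSet_Ioi (a := t))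
    (Set.disjoint_left.2 fun x (h1 : x ≤ t) (h2 : t < x) => not_lt.2 h1 h2) i
  have e : {y : Fin J → ℝ | (Finset.univ.filter fun j => y j ≤ t).card = i}
      = {y | (∀ j, y j ∈ Set.Iic t ∪ Set.Ioi t)
        ∧ (Finset.univ.filter fun j => y j ∈ Set.Iic t).card = i} := by
    ext y
    simp
  have hc : μ (Set.Ioi t) = ENNReal.ofReal (1 - cdf μ t) := by
    rw [← Set.compl_Iic, prob_compl_eq_one_sub measurableSet_Iic, ← ofReal_cdf,
      ENNReal.ofReal_sub _ (cdf_nonneg μ t), ENNReal.ofReal_one]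
  have h1 : 0 ≤ 1 - cdf μ t := sub_nonneg.2 (cdf_le_one μ t)
  have h0 := cdf_nonneg μ t
  rw [e, h, hc, ← ofReal_cdf, ← ENNReal.ofReal_pow h0, ← ENNReal.ofReal_pow h1,
    ← ENNReal.ofReal_natCast, ← ENNReal.ofReal_mul (by positivity),
    ← ENNReal.ofReal_mul (by positivity)]
  simp [bernsteinPolynomial]

/-- It suffices to compare half-lines `(-∞, t]`. There both sides are the probability that at least
`k + 1` observations are at most `t`, a sum of Bernstein polynomials at `F t`. The reference measure
is `μ` itself, so no Lebesgue density is needed. -/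
theorem map_orderStatistic (μ : Measure ℝ) [IsProbabilityMeasure μ] [NullSingletonClass μ] {J : ℕ}
    (k : Fin J) :
    (Measure.pi fun _ : Fin J => μ).map (fun y => orderStatistic y k)
      = μ.withDensity fun y => ENNReal.ofReal (orderDensity J k (cdf μ y)) := by
  have hm := measurable_orderStatistic k
  have : IsProbabilityMeasure ((Measure.pi fun _ : Fin J => μ).map fun y => orderStatistic y k) :=
    Measure.isProbabilityMeasure_map hm.aemeasurable
  refine Measure.ext_of_Iic _ _ fun t => ?_
  have hw : Measurable fun u => ENNReal.ofReal (orderDensity J k u) :=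
    (continuous_orderDensity J k).measurable.ennreal_ofReal
  rw [Measure.map_apply hm measurableSet_Iic, withDensity_apply _ measurableSet_Iic,
    setLIntegral_Iic_comp_cdf μ hw, ← ofReal_integral_eq_lintegral_ofReal
      ((continuous_orderDensity J k).integrableOn_Icc)
      ((ae_restrict_mem measurableSet_Icc).mono fun u hu =>
        orderDensity_nonneg hu.1 (hu.2.trans (cdf_le_one μ t))),
    integral_Icc_eq_integral_Ioc, ← intervalIntegral.integral_of_le (cdf_nonneg μ t),
    integral_orderDensity k.2]
  have e : (fun y => orderStatistic y k) ⁻¹' Set.Iic t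
      = ⋃ i ∈ Finset.Icc ((k:ℕ) + 1) J,
        {y : Fin J → ℝ | (Finset.univ.filter fun j => y j ≤ t).card = i} := by
    ext y
    have : (Finset.univ.filter fun j => y j ≤ t).card ≤ J :=
      (Finset.card_le_univ _).trans (by simp)
    simp [orderStatistic_le_iff, this]
  rw [e, measure_biUnion_finset]
  · rw [ENNReal.ofReal_sum_of_nonneg]
    · exact Finset.sum_congr rfl fun i _ => measure_card_filter_le_eq μ J i t
    · intro i _
      have := sub_nonneg.2 (cdf_le_one μ t)
      have := cdf_nonneg μ t
      simp only [bernsteinPolynomial, Polynomial.eval_mul, Polynomial.eval_natCast,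
        Polynomial.eval_pow, Polynomial.eval_X, Polynomial.eval_sub, Polynomial.eval_one]
      positivity
  · intro i _ j _ hij
    rw [Function.onFun, Set.disjoint_left]
    exact fun y hi hj => hij (hi.symm.trans hj)
  · exact fun i _ => measurableSet_eq_fun (measurable_card_filter_le t) measurable_const

section Expectation
variable (μ : Measure ℝ) [IsProbabilityMeasure μ] [NullSingletonClass μ]

theorem integral_comp_orderStatistic {J : ℕ} (k : Fin J) {g : ℝ → ℝ} (hg : Measurable g) :
    ∫ y, g (orderStatistic y k) ∂(Measure.pi fun _ : Fin J => μ)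
      = ∫ y, orderDensity J k (cdf μ y) * g y ∂μ := by
  rw [← integral_map (measurable_orderStatistic k).aemeasurable hg.aestronglyMeasurable,
    map_orderStatistic, integral_withDensity_eq_integral_toReal_smul]
  · refine integral_congr_ae (.of_forall fun y => ?_)
    simp only [smul_eq_mul]
    rw [ENNReal.toReal_ofReal (orderDensity_nonneg (cdf_nonneg μ y) (cdf_le_one μ y))]
  · exact ((continuous_orderDensity J k).measurable.comp
      (continuous_cdf μ).measurable).ennreal_ofReal
  · exact .of_forall fun y => ENNReal.ofReal_lt_top

end Expectation

/-- The centred moments of the uniform order statistics. -/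
noncomputable def orderMoment (J k r : ℕ) : ℝ :=
  ∫ u in (0:ℝ)..1, orderDensity J k u * (u - 1 / 2) ^ r

theorem orderMoment_zero {J k : ℕ} (hk : k < J) : orderMoment J k 0 = 1 := by
  simp [orderMoment, integral_orderDensity_one hk]

/-- With `l = J - 1 - k`, the derivative of `(u - 1/2)^r u^(k+1) (1 - u)^(l+1)` has integral zero
over `[0, 1]`. The recursion follows from `u (1 - u) = 1/4 - (u - 1/2)²` and `(k+1)(1-u) - (l+1)u =
(2k+1-J)/2 - (J+1)(u - 1/2)`. For `r = 0` the truncated `r - 1` is harmless, its factor being zero.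
-/
theorem orderMoment_recursion {J k : ℕ} (hk : k < J) (r : ℕ) :
    (J + 1 + r : ℝ) * orderMoment J k (r + 1)
      = (2 * k + 1 - J) / 2 * orderMoment J k r + r / 4 * orderMoment J k (r - 1) := by
  obtain ⟨l, rfl⟩ : ∃ l, J = k + l + 1 := ⟨J - 1 - k, by omega⟩
  set c : ℝ := ((k + l + 1 : ℕ) : ℝ) * ((k + l + 1 - 1).choose k : ℝ) with hc
  have hw : ∀ u, orderDensity (k + l + 1) k u = c * (u ^ k * (1 - u) ^ l) := fun u => by
    rw [orderDensity_eq]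
    simp [hc]
  have hd : ∀ u : ℝ, HasDerivAt (fun u : ℝ => (u - 1 / 2) ^ r * (u ^ (k + 1) * (1 - u) ^ (l + 1)))
      (r * (u - 1 / 2) ^ (r - 1) * (u ^ (k + 1) * (1 - u) ^ (l + 1))
        + (u - 1 / 2) ^ r * (u ^ k * (1 - u) ^ l * ((k + 1) * (1 - u) - (l + 1) * u))) u := by
    intro u
    have h1 := ((hasDerivAt_id u).sub_const (1 / 2)).pow r
    have h2 := (hasDerivAt_id u).pow (k + 1)
    have h3 := ((hasDerivAt_id u).const_sub 1).pow (l + 1)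
    refine (h1.mul (h2.mul h3)).congr_deriv ?_
    simp only [id_eq, Pi.pow_apply, Pi.mul_apply, Nat.add_sub_cancel]
    push_cast
    ring
  have hI := intervalIntegral.integral_eq_sub_of_hasDerivAt (a := 0) (b := 1) (fun u _ => hd u)
    (Continuous.intervalIntegrable (by fun_prop) _ _)
  simp only [sub_self, ne_eq, Nat.add_eq_zero_iff, one_ne_zero, and_false, not_false_eq_true,
    zero_pow, mul_zero, zero_mul] at hI
  unfold orderMoment
  simp_rw [hw]
  rw [← sub_eq_zero, ← intervalIntegral.integral_const_mul, ← intervalIntegral.integral_const_mul,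
    ← intervalIntegral.integral_const_mul, ← intervalIntegral.integral_add,
    ← intervalIntegral.integral_sub]
  · rw [← neg_eq_zero, ← intervalIntegral.integral_neg]
    refine Eq.trans ?_ (mul_eq_zero_of_right c hI)
    rw [← intervalIntegral.integral_const_mul]
    refine intervalIntegral.integral_congr fun u _ => ?_
    cases r with
    | zero => push_cast; ring
    | succ r => 
      push_cast
      ring
  all_goals exact Continuous.intervalIntegrable (by fun_prop) _ _

theorem orderMoment_one {J k : ℕ} (hk : k < J) : orderMoment J k 1 = (2 * k + 1 - J) / (2 * (J + 1)) := by
  have h := orderMoment_recursion hk 0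
  rw [orderMoment_zero hk] at h
  field_simp
  push_cast at h
  linarith

theorem abs_two_mul_add_one_sub_le {J k : ℕ} (h1 : 2 * k ≤ J) (h2 : J ≤ 2 * k + 2) :
    |(2 * k + 1 - J : ℝ)| ≤ 1 := by
  have h1' : (2 * k : ℝ) ≤ J := by exact_mod_cast h1
  have h2' : (J : ℝ) ≤ 2 * k + 2 := by exact_mod_cast h2
  rw [abs_le]
  constructor <;> linarith

/-- The hypotheses on `k` single out the middle indices `(J - 1) / 2` and `J / 2`. For them `|2k + 1
- J| ≤ 1`, so that the recursion gains a factor `1/J` for every two orders. -/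
theorem orderMoment_bounds {J k : ℕ} (hk : k < J) (h1 : 2 * k ≤ J) (h2 : J ≤ 2 * k + 2) :
    |orderMoment J k 2| ≤ 1 / J ∧ |orderMoment J k 2 - 1 / (4 * J)| ≤ 1 / J ^ 2 ∧
      |orderMoment J k 3| ≤ 1 / J ^ 2 ∧ |orderMoment J k 4| ≤ 1 / J ^ 2 := by
  have hJ : (1:ℝ) ≤ J := by exact_mod_cast (Nat.zero_le k).trans_lt hk
  have hd := abs_two_mul_add_one_sub_le h1 h2
  have e1 := orderMoment_one hk
  have e2 := orderMoment_recursion hk 1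
  have e3 := orderMoment_recursion hk 2
  have e4 := orderMoment_recursion hk 3
  rw [orderMoment_zero hk] at e2
  norm_num at e2 e3 e4
  set d : ℝ := 2 * k + 1 - J
  set x : ℝ := (J : ℝ)
  set m1 := orderMoment J k 1
  set m2 := orderMoment J k 2
  set m3 := orderMoment J k 3
  set m4 := orderMoment J k 4
  have hd2 : d ^ 2 ≤ 1 := by rw [← sq_abs]; exact pow_le_one₀ (abs_nonneg _) hd
  have e2' : m2 = (d ^ 2 + (x + 1)) / (4 * (x + 1) * (x + 2)) := by
    rw [e1] at e2
    field_simp at e2 ⊢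
    linarith
  have b1 : |m1| ≤ 1 / (2 * x) := by
    rw [e1, abs_div, abs_of_pos (show 0 < 2 * (x + 1) by linarith)]
    gcongr
    linarith
  have p2 : 0 ≤ m2 := by rw [e2']; positivity
  have b2 : m2 ≤ 1 / (4 * x) := by
    rw [e2', div_le_div_iff₀ (by positivity) (by positivity)]
    nlinarith
  have b3 : |m3| ≤ 1 / (2 * x ^ 2) := by
    have : (x + 1 + 2) * |m3| ≤ 1 / 2 * (1 / (4 * x)) + 1 / 2 * (1 / (2 * x)) := by
      rw [← abs_of_pos (show 0 < x + 1 + 2 by linarith), ← abs_mul, e3]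
      refine (abs_add_le _ _).trans ?_
      rw [abs_mul, abs_mul, abs_div, abs_of_nonneg p2]
      norm_num
      have : |d| / 2 * m2 ≤ 1 / 2 * (1 / (4 * x)) := by gcongr
      have : 1 / 2 * |m1| ≤ 1 / 2 * (1 / (2 * x)) := by gcongr
      norm_num at *
      linarith
    have h' : x * |m3| ≤ 1 / (2 * x) := by
      have : 1 / 2 * (1 / (4 * x)) + 1 / 2 * (1 / (2 * x)) ≤ 1 / (2 * x) := by
        field_simp; norm_num
      nlinarith [abs_nonneg m3]
    rw [le_div_iff₀ (by positivity)] at h' ⊢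
    linarith
  refine ⟨?_, ?_, b3.trans (by gcongr; nlinarith), ?_⟩
  · rw [abs_of_nonneg p2]
    exact b2.trans (by gcongr; linarith)
  · have : m2 - 1 / (4 * x) = (d ^ 2 * x - 2 * x - 2) / (4 * x * (x + 1) * (x + 2)) := by
      rw [e2']; field_simp; ring
    rw [this, abs_div, abs_of_pos (show 0 < 4 * x * (x + 1) * (x + 2) by positivity),
      div_le_div_iff₀ (by positivity) (by positivity)]
    have : |d ^ 2 * x - 2 * x - 2| ≤ 4 * x := by
      rw [abs_le]; constructor <;> nlinarith
    calc |d ^ 2 * x - 2 * x - 2| * x ^ 2 ≤ 4 * x * x ^ 2 := by gcongr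
      _ ≤ 1 * (4 * x * (x + 1) * (x + 2)) := by nlinarith
  · have : (x + 1 + 3) * |m4| ≤ 1 / 2 * (1 / (2 * x ^ 2)) + 3 / 4 * (1 / (4 * x)) := by
      rw [← abs_of_pos (show 0 < x + 1 + 3 by linarith), ← abs_mul, e4]
      refine (abs_add_le _ _).trans ?_
      rw [abs_mul, abs_mul, abs_div, abs_of_nonneg p2]
      norm_num
      have : |d| / 2 * |m3| ≤ 1 / 2 * (1 / (2 * x ^ 2)) := by gcongr
      have : 3 / 4 * m2 ≤ 3 / 4 * (1 / (4 * x)) := by gcongr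
      norm_num at *
      linarith
    have h' : x * |m4| ≤ 1 / x := by
      have : 1 / 2 * (1 / (2 * x ^ 2)) + 3 / 4 * (1 / (4 * x)) ≤ 1 / x := by
        field_simp; nlinarith
      nlinarith [abs_nonneg m4]
    rw [le_div_iff₀ (by positivity)] at h' ⊢
    linarith

/-- Away from `1 / 2` the density of a middle order statistic is small. -/
theorem orderDensity_tail {η : ℝ} (hη : 0 < η) : ∃ C : ℝ, 0 ≤ C ∧ ∀ J k : ℕ, k < J →
    2 * k ≤ J → J ≤ 2 * k + 2 → ∀ u : ℝ, 0 ≤ u → u ≤ 1 → η ≤ |u - 1 / 2| →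
      orderDensity J k u ≤ C / J ^ 2 := by
  by_cases hη' : 1 / 2 < η
  · refine ⟨0, le_rfl, fun J k _ _ _ u h0 h1 h => ?_⟩
    have : |u - 1 / 2| ≤ 1 / 2 := by rw [abs_le]; constructor <;> linarith
    linarith
  -- On the tail `u (1 - u) ≤ ρ / 4`. With `s = (J - 1) / 2` the binomial coefficient is at most `2
  -- * 4 ^ s`, so the density is at most `2 J ρ ^ s`, which decays exponentially.
  set ρ : ℝ := 1 - 4 * η ^ 2 with hρ
  have hρ0 : 0 ≤ ρ := by nlinarith
  have hρ1 : ρ < 1 := by nlinarith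
  obtain ⟨B, hB⟩ := (tendsto_pow_const_mul_const_pow_of_abs_lt_one 3
    (abs_lt.2 ⟨by linarith, hρ1⟩ : |ρ| < 1)).bddAbove_range
  have hB : ∀ s : ℕ, (s:ℝ) ^ 3 * ρ ^ s ≤ B := fun s => hB ⟨s, rfl⟩
  have hB0 : 0 ≤ B := by simpa using hB 0
  -- `64 = 2 * 8 * 4`, from the bound `2 J ρ ^ s`, from `J ≤ 2 (s + 1)` cubed, and from `(s + 1)³ ≤
  -- 4 (s³ + 1)`.
  refine ⟨64 * (B + 1), by positivity, fun J k hk h1 h2 u h0 h1' h => ?_⟩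
  have hJ : (0:ℝ) < J := by exact_mod_cast (Nat.zero_le k).trans_lt hk
  set s := (J - 1) / 2 with hs
  have hu : u * (1 - u) ≤ ρ / 4 := by
    have : η ^ 2 ≤ (u - 1 / 2) ^ 2 := by rw [← sq_abs (u - 1 / 2)]; gcongr
    nlinarith
  have hu' := sub_nonneg.2 h1'
  have hp : u ^ k * (1 - u) ^ (J - 1 - k) ≤ (ρ / 4) ^ s := by
    calc u ^ k * (1 - u) ^ (J - 1 - k) ≤ u ^ s * (1 - u) ^ s := by
          refine mul_le_mul (pow_le_pow_of_le_one h0 h1' (by omega))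
            (pow_le_pow_of_le_one hu' (by linarith) (by omega)) (by positivity) (by positivity)
      _ = (u * (1 - u)) ^ s := (mul_pow _ _ _).symm
      _ ≤ _ := by gcongr
  have hch : ((J - 1).choose k : ℝ) ≤ 2 * 4 ^ s := by
    have h3 : (J - 1).choose k ≤ 2 ^ (J - 1) := Nat.choose_le_two_pow _ _
    have h4 : 2 ^ (J - 1) ≤ 2 ^ (2 * s + 1) := Nat.pow_le_pow_right (by norm_num) (by omega)
    have h5 : 2 ^ (2 * s + 1) = 2 * 4 ^ s := by rw [pow_succ, pow_mul]; norm_num [mul_comm]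
    exact_mod_cast (h3.trans h4).trans h5.le
  have hJs : (J : ℝ) ≤ 2 * (s + 1) := by
    have : J ≤ 2 * (s + 1) := by omega
    exact_mod_cast this
  have hw : orderDensity J k u ≤ 2 * J * ρ ^ s := by
    rw [orderDensity_eq]
    calc (J * ((J - 1).choose k : ℝ)) * (u ^ k * (1 - u) ^ (J - 1 - k))
        ≤ (J * (2 * 4 ^ s)) * (ρ / 4) ^ s := by gcongr
      _ = 2 * J * ρ ^ s := by rw [div_pow]; field_simp
  rw [le_div_iff₀ (by positivity)]
  have hpos : 0 ≤ ρ ^ s := by positivity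
  have hle1 : ρ ^ s ≤ 1 := pow_le_one₀ hρ0 hρ1.le
  have hs3 : ((s:ℝ) + 1) ^ 3 ≤ 4 * (s ^ 3 + 1) := by
    have : (0:ℝ) ≤ s := by positivity
    nlinarith [sq_nonneg ((s:ℝ) - 1)]
  calc orderDensity J k u * J ^ 2 ≤ 2 * J * ρ ^ s * J ^ 2 := by gcongr
    _ = 2 * (J ^ 3 * ρ ^ s) := by ring
    _ ≤ 2 * ((2 * (s + 1)) ^ 3 * ρ ^ s) := by gcongr
    _ = 16 * ((s + 1) ^ 3 * ρ ^ s) := by ring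
    _ ≤ 16 * (4 * (s ^ 3 + 1) * ρ ^ s) := by gcongr
    _ = 64 * (s ^ 3 * ρ ^ s + ρ ^ s) := by ring
    _ ≤ 64 * (B + 1) := by gcongr; exact hB s

/-! ### The gap between consecutive order statistics on the scale of `F` -/

section Spacing
variable (μ : Measure ℝ) [IsProbabilityMeasure μ]

theorem measure_Ico_eq_cdf [NullSingletonClass μ] (a b : ℝ) :
    μ (Set.Ico a b) = ENNReal.ofReal (cdf μ b - cdf μ a) := by
  rw [measure_congr Ico_ae_eq_Ioc]
  nth_rewrite 1 [← measure_cdf μ]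
  exact (cdf μ).measure_Ioc a b

theorem setLIntegral_Ici_one_sub_cdf_pow_le [NullSingletonClass μ] (l : ℕ) (s : ℝ) :
    ∫⁻ t in Set.Ici s, ENNReal.ofReal ((1 - cdf μ t) ^ l) ∂μ
      ≤ ENNReal.ofReal ((1 - cdf μ s) ^ (l + 1) / (l + 1)) := by
  have hg : Measurable fun u : ℝ => ENNReal.ofReal ((1 - u) ^ l) := by fun_prop
  calc ∫⁻ t in Set.Ici s, ENNReal.ofReal ((1 - cdf μ t) ^ l) ∂μ
      ≤ ∫⁻ t in cdf μ ⁻¹' Set.Ici (cdf μ s), ENNReal.ofReal ((1 - cdf μ t) ^ l) ∂μ :=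
        lintegral_mono_set fun t ht => monotone_cdf μ ht
    _ = ∫⁻ u in Set.Icc (cdf μ s) 1, ENNReal.ofReal ((1 - u) ^ l) := by
        rw [← setLIntegral_map measurableSet_Ici hg (continuous_cdf μ).measurable, map_cdf,
          Measure.restrict_restrict measurableSet_Ici]
        congr 2
        ext y; simp only [Set.mem_inter_iff, Set.mem_Ici, Set.mem_Icc]
        have := cdf_nonneg μ s
        constructor
        · intro h; exact ⟨h.1, h.2.2⟩
        · intro h; exact ⟨h.1, this.trans h.1, h.2⟩
    _ = ENNReal.ofReal ((1 - cdf μ s) ^ (l + 1) / (l + 1)) := by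
        rw [← ofReal_integral_eq_lintegral_ofReal
          (Continuous.integrableOn_Icc (by fun_prop))
          ((ae_restrict_mem measurableSet_Icc).mono fun u hu => by
            have := sub_nonneg.2 hu.2
            positivity),
          integral_Icc_eq_integral_Ioc, ← intervalIntegral.integral_of_le (cdf_le_one μ s),
          intervalIntegral.integral_comp_sub_left (fun x => x ^ l)]
        simp

/-- Integrating out `t` leaves `J.choose i * F^i (1 - F)^(J-i+1) / (J-i+1)` as a bound. This is the
density of index `i` in a sample of size `J + 2`, divided by `(J+1)(J+2)`, and that density has
integral one. -/
theorem lintegral_lintegral_cdf_pow_le [NullSingletonClass μ] {J i : ℕ} (hi : i ≤ J) :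
    ∫⁻ s, ∫⁻ t in Set.Ici s, (J.choose i : ℝ≥0∞) * μ (Set.Iic s) ^ i * μ (Set.Ioi t) ^ (J - i) ∂μ ∂μ
      ≤ ENNReal.ofReal (1 / ((J + 1) * (J + 2))) := by
  have hc : ∀ t, μ (Set.Ioi t) = ENNReal.ofReal (1 - cdf μ t) := fun t => by
    rw [← Set.compl_Iic, prob_compl_eq_one_sub measurableSet_Iic, ← ofReal_cdf,
      ENNReal.ofReal_sub _ (cdf_nonneg μ t), ENNReal.ofReal_one]
  have h1 : ∀ t, 0 ≤ 1 - cdf μ t := fun t => sub_nonneg.2 (cdf_le_one μ t)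
  calc ∫⁻ s, ∫⁻ t in Set.Ici s,
        (J.choose i : ℝ≥0∞) * μ (Set.Iic s) ^ i * μ (Set.Ioi t) ^ (J - i) ∂μ ∂μ
      ≤ ∫⁻ s, ENNReal.ofReal (1 / ((J + 1) * (J + 2)) * orderDensity (J + 2) i (cdf μ s)) ∂μ := by
        refine lintegral_mono fun s => ?_
        have hne : (J.choose i : ℝ≥0∞) * μ (Set.Iic s) ^ i ≠ ⊤ :=
          ENNReal.mul_ne_top (ENNReal.natCast_ne_top _) (ENNReal.pow_ne_top (measure_ne_top _ _))
        simp only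
        rw [lintegral_const_mul' _ _ hne]
        simp_rw [hc, ← ENNReal.ofReal_pow (h1 _)]
        refine (mul_le_mul_right (setLIntegral_Ici_one_sub_cdf_pow_le μ (J - i) s) _).trans ?_
        rw [← ofReal_cdf, ← ENNReal.ofReal_pow (cdf_nonneg μ s), ← ENNReal.ofReal_natCast,
          ← ENNReal.ofReal_mul (by positivity), ← ENNReal.ofReal_mul (by
            have := cdf_nonneg μ s; positivity)]
        refine ENNReal.ofReal_le_ofReal (le_of_eq ?_)
        rw [orderDensity_eq]
        have hch : ((J + 1).choose i : ℝ) * (J - i + 1) = J.choose i * (J + 1) := by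
          have := Nat.choose_mul_succ_eq J i
          have h' : ((J + 1 - i : ℕ) : ℝ) = J - i + 1 := by
            rw [Nat.cast_sub (by omega)]; push_cast; ring
          rw [← h']
          exact_mod_cast this.symm
        have e : J + 2 - 1 - i = J - i + 1 := by omega
        have e' : J + 2 - 1 = J + 1 := by omega
        rw [e, e', Nat.cast_sub hi]
        have hpos : (0:ℝ) < J - i + 1 := by
          have : (i:ℝ) ≤ J := by exact_mod_cast hi
          linarith
        have hch' : (J.choose i : ℝ) = ((J + 1).choose i : ℝ) * (J - i + 1) / (J + 1) := by
          rw [hch]; field_simp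
        rw [hch']
        push_cast
        field_simp
    _ = ENNReal.ofReal (1 / ((J + 1) * (J + 2))) := by
        rw [lintegral_comp_cdf μ
          (g := fun u => ENNReal.ofReal (1 / ((J + 1) * (J + 2)) * orderDensity (J + 2) i u))
          ((continuous_orderDensity _ _).measurable.const_mul _).ennreal_ofReal,
          ← ofReal_integral_eq_lintegral_ofReal
          (((continuous_orderDensity _ _).const_mul _).integrableOn_Icc)
          ((ae_restrict_mem measurableSet_Icc).mono fun u hu =>
            mul_nonneg (by positivity) (orderDensity_nonneg hu.1 hu.2)),
          integral_Icc_eq_integral_Ioc, ← intervalIntegral.integral_of_le zero_le_one,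
          intervalIntegral.integral_const_mul, integral_orderDensity_one (by omega), mul_one]

/-- On this event at least `l` observations are at most `s` and at most `l` are at most `t`. Hence
exactly `l` lie in `(-∞, s]`, and the others exceed `t`. -/
theorem measure_orderStatistic_gap_le {J : ℕ} {k l : Fin J} (hkl : (l : ℕ) = k + 1) {s t : ℝ}
    (hst : s ≤ t) :
    (Measure.pi fun _ : Fin J => μ) {y | orderStatistic y k ≤ s ∧ t < orderStatistic y l}
      ≤ (J.choose l : ℝ≥0∞) * μ (Set.Iic s) ^ (l : ℕ) * μ (Set.Ioi t) ^ (J - l) := by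
  classical
  rw [← measure_pi_card_eq μ measurableSet_Iic measurableSet_Ioi
    (Set.disjoint_left.2 fun x (h1 : x ≤ s) (h2 : t < x) => absurd (h1.trans hst) (not_le.2 h2))]
  refine measure_mono fun y hy => ?_
  obtain ⟨h1, h2⟩ := hy
  rw [orderStatistic_le_iff] at h1
  rw [← not_le, orderStatistic_le_iff, not_lt] at h2
  have hsub : (Finset.univ.filter fun j => y j ≤ s) ⊆ Finset.univ.filter fun j => y j ≤ t :=
    Finset.monotone_filter_right _ fun j _ (hj : y j ≤ s) => hj.trans hst
  have hcard := Finset.card_le_card hsub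
  have heq := Finset.eq_of_subset_of_card_le hsub (by omega)
  refine ⟨fun j => ?_, ?_⟩
  · by_cases hj : y j ≤ t
    · have : j ∈ Finset.univ.filter fun j => y j ≤ s := by rw [heq]; simpa using hj
      exact Or.inl (by simpa using this)
    · exact Or.inr (not_le.1 hj)
  · simp only [Set.mem_Iic]
    omega

/-- For a gap from `a` to `b`, the squared increment of `F` is the `μ.prod μ`-mass of `[a, b)²`. By
the symmetry of swapping coordinates it is at most twice the mass of the half `s ≤ t`. Fubini then
fixes `(s, t)` and asks for the probability that the gap of the sample covers both points. -/
theorem lintegral_sq_spacing_le [NullSingletonClass μ] {J : ℕ} {k l : Fin J} (hkl : (l : ℕ) = k + 1) :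
    ∫⁻ y, ENNReal.ofReal ((cdf μ (orderStatistic y l) - cdf μ (orderStatistic y k)) ^ 2)
      ∂(Measure.pi fun _ : Fin J => μ) ≤ 2 * ENNReal.ofReal (1 / ((J + 1) * (J + 2))) := by
  set ν := Measure.pi fun _ : Fin J => μ
  have hk := measurable_orderStatistic k
  have hl := measurable_orderStatistic l
  set E : Set ((Fin J → ℝ) × (ℝ × ℝ)) :=
    {p | (orderStatistic p.1 k ≤ p.2.1 ∧ p.2.2 < orderStatistic p.1 l) ∧ p.2.1 ≤ p.2.2} with hE
  have hEm : MeasurableSet E :=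
    ((measurableSet_le (hk.comp measurable_fst) (measurable_fst.comp measurable_snd)).inter
      (measurableSet_lt (measurable_snd.comp measurable_snd) (hl.comp measurable_fst))).inter
      (measurableSet_le (measurable_fst.comp measurable_snd) (measurable_snd.comp measurable_snd))
  have hpt : ∀ y, ENNReal.ofReal ((cdf μ (orderStatistic y l) - cdf μ (orderStatistic y k)) ^ 2)
      ≤ 2 * (μ.prod μ) (Prod.mk y ⁻¹' E) := by
    intro y
    set a := orderStatistic y k
    set b := orderStatistic y l
    have hab : a ≤ b := orderStatistic_mono y (by rw [Fin.le_def]; omega)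
    have hD : MeasurableSet (Prod.mk y ⁻¹' E) := measurable_prodMk_left hEm
    rw [ENNReal.ofReal_pow (sub_nonneg.2 (monotone_cdf μ hab)), ← measure_Ico_eq_cdf, sq,
      ← Measure.prod_prod, two_mul]
    have hsw : (μ.prod μ) (Prod.swap ⁻¹' (Prod.mk y ⁻¹' E)) = (μ.prod μ) (Prod.mk y ⁻¹' E) := by
      rw [← Measure.map_apply measurable_swap hD, Measure.prod_swap]
    refine le_trans ?_ (add_le_add le_rfl hsw.le)
    refine (measure_mono fun p hp => ?_).trans (measure_union_le _ _)
    obtain ⟨⟨h1, h2⟩, h3, h4⟩ := hp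
    rcases le_total p.1 p.2 with h | h
    · exact Or.inl ⟨⟨h1, h4⟩, h⟩
    · exact Or.inr ⟨⟨h3, h2⟩, h⟩
  calc _ ≤ ∫⁻ y, 2 * (μ.prod μ) (Prod.mk y ⁻¹' E) ∂ν := lintegral_mono hpt
    _ = 2 * (ν.prod (μ.prod μ)) E := by
        rw [lintegral_const_mul _ (measurable_measure_prodMk_left hEm), Measure.prod_apply hEm]
    _ = 2 * ∫⁻ p, ν ((fun y => (y, p)) ⁻¹' E) ∂(μ.prod μ) := by
        rw [Measure.prod_apply_symm hEm]
    _ = 2 * ∫⁻ s, ∫⁻ t, ν ((fun y => (y, (s, t))) ⁻¹' E) ∂μ ∂μ := by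
        rw [lintegral_prod _ (measurable_measure_prodMk_right hEm).aemeasurable]
    _ ≤ 2 * ∫⁻ s, ∫⁻ t in Set.Ici s,
          (J.choose l : ℝ≥0∞) * μ (Set.Iic s) ^ (l : ℕ) * μ (Set.Ioi t) ^ (J - l) ∂μ ∂μ := by
        refine mul_le_mul_right (lintegral_mono fun s => ?_) 2
        simp only
        rw [← lintegral_indicator measurableSet_Ici]
        refine lintegral_mono fun t => ?_
        by_cases hst : s ≤ t
        · rw [Set.indicator_of_mem (by exact hst)]
          refine (measure_mono fun y hy => ?_).trans (measure_orderStatistic_gap_le μ hkl hst)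
          exact hy.1
        · rw [Set.indicator_of_notMem (by exact hst)]
          have : (fun y => (y, (s, t))) ⁻¹' E = ∅ := by
            ext y
            exact iff_of_false (fun h => hst h.2) id
          simp [this]
    _ ≤ _ := by
        gcongr
        exact lintegral_lintegral_cdf_pow_le μ l.2.le

theorem integral_sq_spacing_le [NullSingletonClass μ] {J : ℕ} {k l : Fin J} (hkl : (l : ℕ) = k + 1) :
    ∫ y, (cdf μ (orderStatistic y l) - cdf μ (orderStatistic y k)) ^ 2
      ∂(Measure.pi fun _ : Fin J => μ) ≤ 2 / J ^ 2 := by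
  have hJ : (0:ℝ) < J := by exact_mod_cast (Nat.zero_le _).trans_lt k.2
  have hc := (continuous_cdf μ).measurable
  have hm : Measurable fun y : Fin J → ℝ =>
      (cdf μ (orderStatistic y l) - cdf μ (orderStatistic y k)) ^ 2 :=
    ((hc.comp (measurable_orderStatistic l)).sub
      (hc.comp (measurable_orderStatistic k))).pow_const 2
  rw [integral_eq_lintegral_of_nonneg_ae (.of_forall fun y => sq_nonneg _) hm.aestronglyMeasurable]
  refine ENNReal.toReal_le_of_le_ofReal (by positivity)
    ((lintegral_sq_spacing_le μ hkl).trans ?_)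
  rw [show (2 : ℝ≥0∞) = ENNReal.ofReal 2 by simp, ← ENNReal.ofReal_mul (by norm_num)]
  refine ENNReal.ofReal_le_ofReal ?_
  rw [mul_one_div]
  gcongr
  nlinarith

end Spacing

/-! ### From expansions in powers of `F - 1/2` to expansions of expectations -/

section Middle
variable (μ : Measure ℝ)

/-- Within distance `δ` of `m` this is the growth hypothesis applied between `y` and `m`. Further
out, monotonicity of `F` preserves the bound attained at `m ± δ`. -/
theorem mul_abs_sub_le_abs_cdf_sub_half {m c δ : ℝ} (hδ : 0 < δ) (hm : cdf μ m = 1 / 2)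
    (hinc : ∀ y y', m - δ ≤ y → y ≤ y' → y' ≤ m + δ → c * (y' - y) ≤ cdf μ y' - cdf μ y) (y : ℝ) :
    (|y - m| ≤ δ → c * |y - m| ≤ |cdf μ y - 1 / 2|) ∧
      (δ ≤ |y - m| → c * δ ≤ |cdf μ y - 1 / 2|) := by
  have near : ∀ y, |y - m| ≤ δ → c * |y - m| ≤ |cdf μ y - 1 / 2| := fun y hy => by
    rw [abs_le] at hy
    rcases le_total m y with h | h
    · have := hinc m y (by linarith) h (by linarith)
      rw [abs_of_nonneg (sub_nonneg.2 h), hm.symm]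
      exact this.trans (le_abs_self _)
    · have := hinc y m (by linarith) h (by linarith)
      rw [abs_of_nonpos (sub_nonpos.2 h), hm.symm, abs_sub_comm, neg_sub]
      exact this.trans (le_abs_self _)
  refine ⟨near y, fun hy => ?_⟩
  rcases le_abs'.1 hy with h | h
  · have h1 := hinc (m - δ) m le_rfl (by linarith) (by linarith)
    have h2 := monotone_cdf μ (show y ≤ m - δ by linarith)
    rw [abs_sub_comm]
    refine le_trans ?_ (le_abs_self _)
    linarith
  · have h1 := hinc m (m + δ) (by linarith) (by linarith) le_rfl
    have h2 := monotone_cdf μ (show m + δ ≤ y by linarith)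
    refine le_trans ?_ (le_abs_self _)
    linarith

theorem abs_cdf_sub_half_le (y : ℝ) : |cdf μ y - 1 / 2| ≤ 1 / 2 := by
  have := cdf_nonneg μ y
  have := cdf_le_one μ y
  rw [abs_le]; constructor <;> linarith

/-- A local expansion in powers of `F - 1 / 2` holds globally, up to a term supported away from
the median. -/
theorem exists_abs_sub_comp_cdf_le {m c δ K : ℝ} {φ q : ℝ → ℝ} {r : ℕ} (hc : 0 < c) (hδ : 0 < δ)
    (hm : cdf μ m = 1 / 2)
    (hinc : ∀ y y', m - δ ≤ y → y ≤ y' → y' ≤ m + δ → c * (y' - y) ≤ cdf μ y' - cdf μ y)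
    (hφ : ∀ y, |φ y| ≤ K * (1 + (y - m) ^ 2)) (hq : Continuous q)
    (hO : (fun y => φ y - q (cdf μ y - 1 / 2)) =O[𝓝 m] fun y => (y - m) ^ r) :
    ∃ η > 0, ∃ C ≥ 0, ∀ y, |φ y - q (cdf μ y - 1 / 2)|
      ≤ C * (|cdf μ y - 1 / 2| ^ r
        + {y | η ≤ |cdf μ y - 1 / 2|}.indicator (fun y => (y - m) ^ 2) y) := by
  obtain ⟨C₁, hC₁, hO⟩ := hO.exists_nonneg
  obtain ⟨ε, hε, hball⟩ := Metric.eventually_nhds_iff.1 hO.bound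
  obtain ⟨Q, hQ⟩ := (isCompact_Icc (a := (-(1 / 2) : ℝ)) (b := 1 / 2)).exists_bound_of_continuousOn
    hq.continuousOn
  have hQ' : ∀ y, |q (cdf μ y - 1 / 2)| ≤ Q := fun y => hQ _ (abs_le.1 (abs_cdf_sub_half_le μ y))
  have hQ0 : 0 ≤ Q := (abs_nonneg _).trans (hQ' m)
  have hK0 : 0 ≤ K := by simpa using (abs_nonneg _).trans (hφ m)
  set δ' := min δ (ε / 2) with hδ'
  have hδ'0 : 0 < δ' := lt_min hδ (by positivity)
  have hinc' : ∀ y y', m - δ' ≤ y → y ≤ y' → y' ≤ m + δ' → c * (y' - y) ≤ cdf μ y' - cdf μ y :=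
    fun y y' h1 h2 h3 => hinc y y' (by linarith [min_le_left δ (ε / 2)]) h2
      (by linarith [min_le_left δ (ε / 2)])
  have hloc := mul_abs_sub_le_abs_cdf_sub_half μ hδ'0 hm hinc'
  -- Leaving the `δ'`-neighbourhood of `m` forces `|F - 1/2| ≥ c δ'`. The first constant is the
  -- local one, with `|y - m| ≤ c⁻¹ |F - 1/2|`; the others come from `1 ≤ (y - m)² / δ'²` outside.
  refine ⟨c * δ', by positivity, C₁ * c⁻¹ ^ r + (K * (1 / δ' ^ 2 + 1) + Q / δ' ^ 2),
    by positivity, fun y => ?_⟩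
  have hind : 0 ≤ {y | c * δ' ≤ |cdf μ y - 1 / 2|}.indicator (fun y => (y - m) ^ 2) y :=
    Set.indicator_nonneg (fun _ _ => sq_nonneg _) _
  rcases le_total |y - m| δ' with h | h
  · have h1 := (hloc y).1 h
    have h2 : |φ y - q (cdf μ y - 1 / 2)| ≤ C₁ * |y - m| ^ r := by
      have := hball (y := y) (by
        rw [Real.dist_eq]
        linarith [min_le_right δ (ε / 2)])
      simpa using this
    have h3 : |y - m| ≤ c⁻¹ * |cdf μ y - 1 / 2| := by
      rw [inv_mul_eq_div, le_div_iff₀ hc]; linarith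
    calc |φ y - q (cdf μ y - 1 / 2)| ≤ C₁ * (c⁻¹ * |cdf μ y - 1 / 2|) ^ r := h2.trans (by gcongr)
      _ = C₁ * c⁻¹ ^ r * |cdf μ y - 1 / 2| ^ r := by rw [mul_pow]; ring
      _ ≤ _ := by
        gcongr
        · exact le_add_of_nonneg_right (by positivity)
        · exact le_add_of_nonneg_right hind
  · have h1 := (hloc y).2 h
    rw [Set.indicator_of_mem (by exact h1)]
    have hx : 1 ≤ (y - m) ^ 2 / δ' ^ 2 := by
      rw [one_le_div (by positivity), ← sq_abs (y - m)]; gcongr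
    calc |φ y - q (cdf μ y - 1 / 2)| ≤ |φ y| + |q (cdf μ y - 1 / 2)| := abs_sub _ _
      _ ≤ K * ((y - m) ^ 2 / δ' ^ 2 + (y - m) ^ 2) + Q * ((y - m) ^ 2 / δ' ^ 2) := by
        refine add_le_add ((hφ y).trans (by gcongr)) ((hQ' y).trans ?_)
        exact le_mul_of_one_le_right hQ0 hx
      _ = (K * (1 / δ' ^ 2 + 1) + Q / δ' ^ 2) * (y - m) ^ 2 := by ring
      _ ≤ _ := by
        refine mul_le_mul (le_add_of_nonneg_left (by positivity))
          (le_add_of_nonneg_left (by positivity)) (sq_nonneg _) (by positivity)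

theorem exists_orderDensity_le (J k : ℕ) :
    ∃ D : ℝ, 0 ≤ D ∧ ∀ y, 0 ≤ orderDensity J k (cdf μ y) ∧ orderDensity J k (cdf μ y) ≤ D := by
  obtain ⟨D, hD⟩ := (isCompact_Icc (a := (0 : ℝ)) (b := 1)).exists_bound_of_continuousOn
    (continuous_orderDensity J k).continuousOn
  have h : ∀ y, |orderDensity J k (cdf μ y)| ≤ D := fun y =>
    hD _ ⟨cdf_nonneg μ y, cdf_le_one μ y⟩
  exact ⟨D, (abs_nonneg _).trans (h 0), fun y =>
    ⟨orderDensity_nonneg (cdf_nonneg μ y) (cdf_le_one μ y), (le_abs_self _).trans (h y)⟩⟩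

variable [IsProbabilityMeasure μ] [NullSingletonClass μ]

theorem measurable_orderDensity_comp_cdf (J k : ℕ) :
    Measurable fun y => orderDensity J k (cdf μ y) :=
  (continuous_orderDensity J k).measurable.comp (continuous_cdf μ).measurable

theorem integrable_orderDensity_mul (J k : ℕ) {g : ℝ → ℝ} (hg : Integrable g μ) :
    Integrable (fun y => orderDensity J k (cdf μ y) * g y) μ := by
  obtain ⟨D, hD0, hD⟩ := exists_orderDensity_le μ J k
  refine hg.bdd_mul (c := D) (measurable_orderDensity_comp_cdf μ J k).aestronglyMeasurable
    (.of_forall fun y => ?_)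
  rw [Real.norm_of_nonneg (hD y).1]
  exact (hD y).2

theorem integrable_comp_cdf {q : ℝ → ℝ} (hq : Continuous q) :
    Integrable (fun y => q (cdf μ y)) μ := by
  obtain ⟨Q, hQ⟩ := (isCompact_Icc (a := (0 : ℝ)) (b := 1)).exists_bound_of_continuousOn
    hq.continuousOn
  exact Integrable.of_bound (hq.comp (continuous_cdf μ)).aestronglyMeasurable Q
    (.of_forall fun y => hQ _ ⟨cdf_nonneg μ y, cdf_le_one μ y⟩)

theorem memLp_orderStatistic {J : ℕ} (k : Fin J) {g : ℝ → ℝ} {p : ℝ≥0∞} (hg : MemLp g p μ)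
    (hgm : Measurable g) :
    MemLp (fun y => g (orderStatistic y k)) p (Measure.pi fun _ : Fin J => μ) := by
  obtain ⟨D, hD0, hD⟩ := exists_orderDensity_le μ J k
  have h : MemLp g p ((Measure.pi fun _ : Fin J => μ).map fun y => orderStatistic y k) := by
    rw [map_orderStatistic]
    refine MemLp.of_measure_le_smul (c := ENNReal.ofReal D) ENNReal.ofReal_ne_top ?_ hg
    rw [← withDensity_const]
    exact withDensity_mono (.of_forall fun y => ENNReal.ofReal_le_ofReal (hD y).2)
  exact (memLp_map_measure_iff hgm.aestronglyMeasurable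
    (measurable_orderStatistic k).aemeasurable).1 h

/-- Integrated against the density of the order statistic, the pointwise error gives two terms. The
even power of `F - 1/2` becomes a centred moment. On the set where `|F - 1/2| ≥ η` the density is
`O(1/J²)`, so the second term costs only `1/J²` times the second moment of `μ`. -/
theorem exists_abs_integral_orderStatistic_sub_le {m η C : ℝ} {φ q : ℝ → ℝ} {r : ℕ}
    (hr : Even r) (hη : 0 < η) (hC : 0 ≤ C) (h2 : Integrable (fun y => (y - m) ^ 2) μ)
    (hφm : Measurable φ) (hq : Continuous q)
    (h : ∀ y, |φ y - q (cdf μ y - 1 / 2)|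
      ≤ C * (|cdf μ y - 1 / 2| ^ r
        + {y | η ≤ |cdf μ y - 1 / 2|}.indicator (fun y => (y - m) ^ 2) y)) :
    ∃ D ≥ 0, ∀ (J : ℕ) (k : Fin J), 2 * (k : ℕ) ≤ J → J ≤ 2 * (k : ℕ) + 2 →
      |(∫ y, φ (orderStatistic y k) ∂(Measure.pi fun _ : Fin J => μ))
        - ∫ u in (0:ℝ)..1, orderDensity J k u * q (u - 1 / 2)|
        ≤ C * orderMoment J k r + D / J ^ 2 := by
  obtain ⟨T, hT0, hT⟩ := orderDensity_tail hη
  have hB0 : 0 ≤ ∫ y, (y - m) ^ 2 ∂μ := integral_nonneg fun _ => sq_nonneg _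
  refine ⟨C * (T * ∫ y, (y - m) ^ 2 ∂μ), by positivity, fun J k hk1 hk2 => ?_⟩
  have hJ : (0:ℝ) < J := by exact_mod_cast (Nat.zero_le _).trans_lt k.2
  have hw : ∀ y, 0 ≤ orderDensity J k (cdf μ y) := fun y =>
    orderDensity_nonneg (cdf_nonneg μ y) (cdf_le_one μ y)
  set S : Set ℝ := {y | η ≤ |cdf μ y - 1 / 2|} with hS
  have hSm : MeasurableSet S :=
    measurableSet_le measurable_const ((continuous_cdf μ).measurable.sub_const _).abs
  have hind := h2.indicator hSm
  have hqi : Integrable (fun y => q (cdf μ y - 1 / 2)) μ :=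
    integrable_comp_cdf μ (q := fun u => q (u - 1 / 2)) (by fun_prop)
  have hvr : Integrable (fun y => (cdf μ y - 1 / 2) ^ r) μ :=
    integrable_comp_cdf μ (q := fun u => (u - 1 / 2) ^ r) (by fun_prop)
  have habs : ∀ y, |cdf μ y - 1 / 2| ^ r = (cdf μ y - 1 / 2) ^ r := fun y => hr.pow_abs _
  simp_rw [habs] at h
  have hdi : Integrable (fun y => φ y - q (cdf μ y - 1 / 2)) μ :=
    ((hvr.add hind).const_mul C).mono'
      (hφm.aestronglyMeasurable.sub hqi.aestronglyMeasurable) (.of_forall h)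
  have hφi : Integrable φ μ := by
    have := hdi.add hqi
    refine this.congr (.of_forall fun y => ?_)
    simp
  rw [integral_comp_orderStatistic μ k hφm,
    ← integral_comp_cdf μ (fun u => orderDensity J k u * q (u - 1 / 2))
      ((continuous_orderDensity J k).mul (by fun_prop)), ← integral_sub
      (integrable_orderDensity_mul μ J k hφi) (integrable_orderDensity_mul μ J k hqi)]
  have hM : ∫ y, orderDensity J k (cdf μ y) * (cdf μ y - 1 / 2) ^ r ∂μ = orderMoment J k r :=
    integral_comp_cdf μ (fun u => orderDensity J k u * (u - 1 / 2) ^ r)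
      ((continuous_orderDensity J k).mul (by fun_prop))
  have hI : ∫ y, orderDensity J k (cdf μ y) * S.indicator (fun y => (y - m) ^ 2) y ∂μ
      ≤ T / J ^ 2 * ∫ y, (y - m) ^ 2 ∂μ := by
    rw [← integral_const_mul]
    refine integral_mono (integrable_orderDensity_mul μ J k hind) (h2.const_mul _) fun y => ?_
    by_cases hy : y ∈ S
    · simp only [Set.indicator_of_mem hy]
      gcongr
      exact hT J k k.2 hk1 hk2 _ (cdf_nonneg μ y) (cdf_le_one μ y) hy
    · simp only [Set.indicator_of_notMem hy, mul_zero]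
      positivity
  calc _ ≤ ∫ y, |orderDensity J k (cdf μ y) * φ y
          - orderDensity J k (cdf μ y) * q (cdf μ y - 1 / 2)| ∂μ := abs_integral_le_integral_abs
    _ ≤ ∫ y, C * (orderDensity J k (cdf μ y) * (cdf μ y - 1 / 2) ^ r
          + orderDensity J k (cdf μ y) * S.indicator (fun y => (y - m) ^ 2) y) ∂μ := by
        refine integral_mono ((integrable_orderDensity_mul μ J k hφi).sub
          (integrable_orderDensity_mul μ J k hqi)).abs
          (((integrable_orderDensity_mul μ J k hvr).add
            (integrable_orderDensity_mul μ J k hind)).const_mul C) fun y => ?_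
        simp only
        rw [← mul_sub, abs_mul, abs_of_nonneg (hw y), ← mul_add, mul_left_comm]
        exact mul_le_mul_of_nonneg_left (h y) (hw y)
    _ = C * (orderMoment J k r
          + ∫ y, orderDensity J k (cdf μ y) * S.indicator (fun y => (y - m) ^ 2) y ∂μ) := by
        rw [integral_const_mul, integral_add (integrable_orderDensity_mul μ J k hvr)
          (integrable_orderDensity_mul μ J k hind), hM]
    _ ≤ C * (orderMoment J k r + T / J ^ 2 * ∫ y, (y - m) ^ 2 ∂μ) := by gcongr
    _ = _ := by ring

/-- The two middle order statistics differ by `O(1 / J)` in mean square. -/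
theorem exists_integral_sq_orderStatistic_sub_le {m c δ : ℝ} (hc : 0 < c) (hδ : 0 < δ)
    (hm : cdf μ m = 1 / 2)
    (hinc : ∀ y y', m - δ ≤ y → y ≤ y' → y' ≤ m + δ → c * (y' - y) ≤ cdf μ y' - cdf μ y)
    (h2 : Integrable (fun y => (y - m) ^ 2) μ) :
    ∃ D ≥ 0, ∀ (J : ℕ) (k l : Fin J), 2 * (k : ℕ) ≤ J → J ≤ 2 * (k : ℕ) + 2 →
      2 * (l : ℕ) ≤ J → J ≤ 2 * (l : ℕ) + 2 → (l : ℕ) = k + 1 →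
      ∫ y, (orderStatistic y l - orderStatistic y k) ^ 2 ∂(Measure.pi fun _ : Fin J => μ)
        ≤ D / J ^ 2 := by
  have hloc := mul_abs_sub_le_abs_cdf_sub_half μ hδ hm hinc
  set S : Set ℝ := {y | c * δ ≤ |cdf μ y - 1 / 2|} with hS
  have hSm : MeasurableSet S :=
    measurableSet_le measurable_const ((continuous_cdf μ).measurable.sub_const _).abs
  set ψ : ℝ → ℝ := S.indicator fun y => (y - m) ^ 2 with hψ
  have hψm : Measurable ψ := Measurable.indicator (by fun_prop) hSm
  have hψ0 : ∀ y, 0 ≤ ψ y := fun y => Set.indicator_nonneg (fun _ _ => sq_nonneg _) _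
  -- `ψ` vanishes where `F` is near `1/2`, so it is compared with `q = 0`. The choice `r = 4` keeps
  -- the moment term at `O(1/J²)`.
  obtain ⟨D, hD0, hD⟩ := exists_abs_integral_orderStatistic_sub_le μ (m := m) (η := c * δ) (C := 1)
    (φ := ψ) (q := fun _ => 0) (r := 4) (by decide) (by positivity) zero_le_one h2 hψm
    continuous_const (fun y => by
      rw [sub_zero, abs_of_nonneg (hψ0 y), one_mul]
      exact le_add_of_nonneg_left (by positivity))
  have hDψ : ∀ (J : ℕ) (k : Fin J), 2 * (k : ℕ) ≤ J → J ≤ 2 * (k : ℕ) + 2 →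
      ∫ y, ψ (orderStatistic y k) ∂(Measure.pi fun _ : Fin J => μ) ≤ (1 + D) / J ^ 2 := by
    intro J k hk1 hk2
    have h := hD J k hk1 hk2
    have hb := (orderMoment_bounds k.2 hk1 hk2).2.2.2
    simp only [mul_zero, intervalIntegral.integral_zero, sub_zero, one_mul] at h
    rw [add_div]
    linarith [le_abs_self (∫ y, ψ (orderStatistic y k) ∂(Measure.pi fun _ : Fin J => μ)),
      le_abs_self (orderMoment J k 4)]
  -- If both points are within `δ` of `m`, the increment of `F` controls their distance. Otherwise
  -- the point farther from `m` lies outside, and the distance is at most twice its distance to `m`;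
  -- this gives the factor `4`.
  have hpt : ∀ x y, (y - x) ^ 2 ≤ (c⁻¹) ^ 2 * (cdf μ y - cdf μ x) ^ 2 + 4 * ψ x + 4 * ψ y := by
    intro x y
    have far : ∀ x y, δ ≤ |y - m| → |x - m| ≤ |y - m| → (y - x) ^ 2 ≤ 4 * ψ y := by
      intro x y h h'
      have : ψ y = (y - m) ^ 2 := Set.indicator_of_mem (by exact (hloc y).2 h) _
      rw [this]
      have := sq_le_sq.2 h'
      nlinarith [sq_nonneg (y - m + (x - m))]
    have hsq : 0 ≤ (c⁻¹) ^ 2 * (cdf μ y - cdf μ x) ^ 2 := by positivity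
    have near : ∀ x y, |x - m| ≤ δ → |y - m| ≤ δ → x ≤ y →
        (y - x) ^ 2 ≤ (c⁻¹) ^ 2 * (cdf μ y - cdf μ x) ^ 2 := by
      intro x y hx hy hxy
      have := hinc x y (by linarith [(abs_le.1 hx).1]) hxy (by linarith [(abs_le.1 hy).2])
      rw [← mul_pow]
      refine pow_le_pow_left₀ (sub_nonneg.2 hxy) ?_ 2
      rw [inv_mul_eq_div, le_div_iff₀ hc]; linarith
    by_cases h : |x - m| ≤ δ ∧ |y - m| ≤ δ
    · have : (y - x) ^ 2 ≤ (c⁻¹) ^ 2 * (cdf μ y - cdf μ x) ^ 2 := by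
        rcases le_total x y with hxy | hxy
        · exact near x y h.1 h.2 hxy
        · have := near y x h.2 h.1 hxy
          nlinarith
      linarith [hψ0 x, hψ0 y]
    · rcases le_total |x - m| |y - m| with hxy | hxy
      · have := far x y (by
          by_contra h'; exact h ⟨hxy.trans (not_le.1 h').le, (not_le.1 h').le⟩) hxy
        linarith [hψ0 x]
      · have := far y x (by
          by_contra h'; exact h ⟨(not_le.1 h').le, hxy.trans (not_le.1 h').le⟩) hxy
        have : (y - x) ^ 2 = (x - y) ^ 2 := by ring
        linarith [hψ0 y]
  refine ⟨(c⁻¹) ^ 2 * 2 + 8 * (1 + D), by positivity, fun J k l hk1 hk2 hl1 hl2 hkl => ?_⟩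
  have hψi : Integrable ψ μ := h2.indicator hSm
  have hi : ∀ k : Fin J, Integrable (fun y => ψ (orderStatistic y k))
      (Measure.pi fun _ : Fin J => μ) := fun k =>
    memLp_one_iff_integrable.1 (memLp_orderStatistic μ k (memLp_one_iff_integrable.2 hψi) hψm)
  have hci : Integrable (fun y => (cdf μ (orderStatistic y l) - cdf μ (orderStatistic y k)) ^ 2)
      (Measure.pi fun _ : Fin J => μ) := by
    have hcm := (continuous_cdf μ).measurable
    have hm' : Measurable fun y : Fin J → ℝ =>
        (cdf μ (orderStatistic y l) - cdf μ (orderStatistic y k)) ^ 2 :=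
      ((hcm.comp (measurable_orderStatistic l)).sub
        (hcm.comp (measurable_orderStatistic k))).pow_const 2
    refine Integrable.of_bound hm'.aestronglyMeasurable 1 (.of_forall fun y => ?_)
    rw [Real.norm_of_nonneg (sq_nonneg _), sq_le_one_iff_abs_le_one, abs_le]
    have := cdf_nonneg μ (orderStatistic y l)
    have := cdf_nonneg μ (orderStatistic y k)
    have := cdf_le_one μ (orderStatistic y l)
    have := cdf_le_one μ (orderStatistic y k)
    constructor <;> linarith
  have hab : Integrable (fun y => (c⁻¹) ^ 2
      * (cdf μ (orderStatistic y l) - cdf μ (orderStatistic y k)) ^ 2 + 4 * ψ (orderStatistic y k))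
      (Measure.pi fun _ : Fin J => μ) := (hci.const_mul _).add ((hi k).const_mul 4)
  calc _ ≤ ∫ y, ((c⁻¹) ^ 2 * (cdf μ (orderStatistic y l) - cdf μ (orderStatistic y k)) ^ 2
          + 4 * ψ (orderStatistic y k) + 4 * ψ (orderStatistic y l))
          ∂(Measure.pi fun _ : Fin J => μ) :=
        integral_mono_of_nonneg (.of_forall fun _ => sq_nonneg _)
          (hab.add ((hi l).const_mul 4))
          (.of_forall fun y => hpt _ _)
    _ ≤ (c⁻¹) ^ 2 * (2 / J ^ 2) + 4 * ((1 + D) / J ^ 2) + 4 * ((1 + D) / J ^ 2) := by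
        rw [integral_add hab ((hi l).const_mul 4),
          integral_add (hci.const_mul _) ((hi k).const_mul 4), integral_const_mul,
          integral_const_mul, integral_const_mul]
        gcongr
        · exact integral_sq_spacing_le μ hkl
        · exact hDψ J k hk1 hk2
        · exact hDψ J l hl1 hl2
    _ = _ := by ring

end Middle

/-! ### The distribution function near the median -/

section Density
variable {μ : Measure ℝ} {f : ℝ → ℝ} {m : ℝ}

theorem IsDensityOf.nullSingletonClass (hf : IsDensityOf f μ) : NullSingletonClass μ where
  measure_singleton x := by
    rw [hf.2.2]
    exact withDensity_absolutelyContinuous _ _ (measure_singleton x)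

theorem IsDensityOf.integrable [IsProbabilityMeasure μ] (hf : IsDensityOf f μ) :
    Integrable f := by
  refine ⟨hf.1.aestronglyMeasurable, ?_⟩
  rw [hasFiniteIntegral_iff_ofReal (.of_forall hf.2.1), ← setLIntegral_univ,
    ← withDensity_apply _ MeasurableSet.univ, ← hf.2.2]
  exact measure_lt_top _ _

theorem IsDensityOf.cdf_sub_cdf [IsProbabilityMeasure μ] (hf : IsDensityOf f μ) (a b : ℝ) :
    cdf μ b - cdf μ a = ∫ x in a..b, f x := by
  have h : ∀ t, cdf μ t = ∫ x in Set.Iic t, f x := fun t => by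
    rw [cdf_eq_real, measureReal_def, hf.2.2, withDensity_apply _ measurableSet_Iic,
      integral_eq_lintegral_of_nonneg_ae (.of_forall hf.2.1) hf.1.aestronglyMeasurable]
  rw [h, h, intervalIntegral.integral_Iic_sub_Iic hf.integrable.integrableOn
    hf.integrable.integrableOn]

theorem IsMedian.cdf_eq [IsProbabilityMeasure μ] [NullSingletonClass μ] (h : IsMedian μ m) :
    cdf μ m = 1 / 2 := by
  have e : μ (Set.Ici m) = ENNReal.ofReal (1 - cdf μ m) := by
    rw [← measure_congr Ioi_ae_eq_Ici, ← Set.compl_Iic, prob_compl_eq_one_sub measurableSet_Iic,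
      ← ofReal_cdf, ENNReal.ofReal_sub _ (cdf_nonneg μ m), ENNReal.ofReal_one]
  have hh : (1 / 2 : ℝ≥0∞) = ENNReal.ofReal (1 / 2) := by
    rw [ENNReal.ofReal_div_of_pos two_pos]; simp
  have h1 := h.1
  have h2 := h.2
  rw [← ofReal_cdf, hh, ENNReal.ofReal_le_ofReal_iff (cdf_nonneg μ m)] at h1
  rw [e, hh, ENNReal.ofReal_le_ofReal_iff (sub_nonneg.2 (cdf_le_one μ m))] at h2
  linarith

theorem IsDensityOf.exists_mul_sub_le_cdf_sub [IsProbabilityMeasure μ] (hf : IsDensityOf f μ)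
    (hc : ContinuousAt f m) (hpos : 0 < f m) :
    ∃ δ > 0, ∀ y y', m - δ ≤ y → y ≤ y' → y' ≤ m + δ →
      f m / 2 * (y' - y) ≤ cdf μ y' - cdf μ y := by
  obtain ⟨ε, hε, h⟩ := Metric.eventually_nhds_iff.1
    (hc.eventually (lt_mem_nhds (half_lt_self hpos)))
  refine ⟨ε / 2, by positivity, fun y y' h1 h2 h3 => ?_⟩
  rw [hf.cdf_sub_cdf, mul_comm, ← smul_eq_mul, ← intervalIntegral.integral_const]
  refine intervalIntegral.integral_mono_on h2 intervalIntegrable_const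
    hf.integrable.intervalIntegrable fun x hx => (h ?_).le
  rw [Real.dist_eq, abs_lt]
  constructor <;> linarith [hx.1, hx.2]

/-- The error is the integral of `f - p` from `m` to `y`, so its order rises by one. Only an
expansion of `f` around the single point `m` is required. -/
theorem IsDensityOf.cdf_sub_isBigO [IsProbabilityMeasure μ] (hf : IsDensityOf f μ)
    {p Q : ℝ → ℝ} {n : ℕ} (hp : Continuous p) (hQ : ∀ x, HasDerivAt Q (p x) x) (hQm : Q m = 0)
    (h : (fun y => f y - p y) =O[𝓝 m] fun y => (y - m) ^ n) :
    (fun y => cdf μ y - cdf μ m - Q y) =O[𝓝 m] fun y => (y - m) ^ (n + 1) := by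
  obtain ⟨C, hC, h⟩ := h.exists_nonneg
  obtain ⟨ε, hε, hball⟩ := Metric.eventually_nhds_iff.1 h.bound
  refine IsBigO.of_bound C (Metric.eventually_nhds_iff.2 ⟨ε, hε, fun y hy => ?_⟩)
  have e : cdf μ y - cdf μ m - Q y = ∫ x in m..y, (f x - p x) := by
    rw [intervalIntegral.integral_sub hf.integrable.intervalIntegrable (hp.intervalIntegrable _ _),
      ← hf.cdf_sub_cdf, intervalIntegral.integral_eq_sub_of_hasDerivAt (fun x _ => hQ x)
      (hp.intervalIntegrable _ _), hQm, sub_zero]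
  rw [e, norm_pow, pow_succ, ← mul_assoc]
  refine intervalIntegral.norm_integral_le_of_norm_le_const fun x hx => ?_
  have hxy : |x - m| ≤ |y - m| := Set.abs_sub_left_of_mem_uIcc (Set.uIoc_subset_uIcc hx)
  refine (hball (by rw [Real.dist_eq]; exact hxy.trans_lt (by rwa [Real.dist_eq] at hy))).trans ?_
  rw [norm_pow]
  gcongr
  exact hxy

theorem IsDensityOf.cdf_isBigO_of_differentiableAt [IsProbabilityMeasure μ]
    (hf : IsDensityOf f μ) (hd : DifferentiableAt ℝ f m) (hm : cdf μ m = 1 / 2) :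
    (fun y => cdf μ y - 1 / 2 - f m * (y - m)) =O[𝓝 m] fun y => (y - m) ^ 2 := by
  rw [← hm]
  refine hf.cdf_sub_isBigO (p := fun _ => f m) continuous_const (fun x => ?_) (by simp) (n := 1) ?_
  · simpa using ((hasDerivAt_id x).sub_const m).const_mul (f m)
  · simpa using hd.isBigO_sub

/-- The cubic coefficient may stay unspecified: in the mean it meets only the third centred moment,
which is `O(1/J²)`. -/
theorem IsDensityOf.cdf_isBigO_of_contDiffAt [IsProbabilityMeasure μ]
    (hf : IsDensityOf f μ) (hd : ContDiffAt ℝ 3 f m) (hm : cdf μ m = 1 / 2) :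
    ∃ c, (fun y => cdf μ y - 1 / 2
      - (f m * (y - m) + deriv f m / 2 * (y - m) ^ 2 + c * (y - m) ^ 3))
      =O[𝓝 m] fun y => (y - m) ^ 4 := by
  obtain ⟨u, hu, hfu⟩ := hd.contDiffOn le_rfl (by simp)
  obtain ⟨ε, hε, hball⟩ := Metric.mem_nhds_iff.1 hu
  set s := Metric.ball m ε
  have hms : m ∈ s := Metric.mem_ball_self hε
  have hs : s ∈ 𝓝 m := Metric.ball_mem_nhds m hε
  have ht := taylor_isLittleO (s := s) (convex_ball m ε) hms
    (n := 3) (by exact_mod_cast hfu.mono hball)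
  rw [nhdsWithin_eq_nhds.2 hs] at ht
  set c₂ := iteratedDerivWithin 2 f s m
  set c₃ := iteratedDerivWithin 3 f s m
  have hT : ∀ x, taylorWithinEval f 3 s m x
      = f m + deriv f m * (x - m) + c₂ / 2 * (x - m) ^ 2 + c₃ / 6 * (x - m) ^ 3 := by
    intro x
    simp only [taylorWithinEval_succ, taylor_within_zero_eval, zero_add, iteratedDerivWithin_one,
      derivWithin_of_mem_nhds hs, smul_eq_mul]
    norm_num [Nat.factorial]
    ring
  simp_rw [hT] at ht
  refine ⟨c₂ / 6, ?_⟩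
  rw [← hm]
  refine hf.cdf_sub_isBigO (n := 3)
    (p := fun x => f m + deriv f m * (x - m) + c₂ / 2 * (x - m) ^ 2) (by fun_prop) (fun x => ?_)
    (by simp) ?_
  · have h1 := (hasDerivAt_id x).sub_const m
    refine (((h1.const_mul (f m)).add ((h1.pow 2).const_mul (deriv f m / 2))).add
      ((h1.pow 3).const_mul (c₂ / 6))).congr_deriv ?_
    simp
    ring
  · refine (ht.isBigO.add ((isBigO_refl (fun x => (x - m) ^ 3) (𝓝 m)).const_mul_left
      (c₃ / 6))).congr_left fun x => ?_
    ring

end Density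

/-! ### Inverting the expansion `v = a x + b x² + c x³ + O(x⁴)` -/

section Inversion
variable {l : Filter ℝ} {x v : ℝ → ℝ} {a b c : ℝ}

theorem isBigO_pow_of_le (hx : Tendsto x l (𝓝 0)) {i j : ℕ} (hij : i ≤ j) :
    (fun y => x y ^ j) =O[l] fun y => x y ^ i := by
  have h : (fun y => x y ^ (j - i) * x y ^ i) =O[l] fun y => (1:ℝ) * x y ^ i :=
    ((hx.pow (j - i)).isBigO_one ℝ).mul (isBigO_refl _ _)
  refine h.congr (fun y => ?_) fun y => one_mul _
  rw [← pow_add, Nat.sub_add_cancel hij]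

theorem isBigO_inversion_one (ha : a ≠ 0)
    (h : (fun y => v y - a * x y) =O[l] fun y => x y ^ 2) :
    (fun y => x y - v y / a) =O[l] fun y => x y ^ 2 := by
  refine (h.const_mul_left (-(1 / a))).congr_left fun y => ?_
  field_simp
  ring

/-- With `P` the cubic polynomial, `v² - P² = (v - P)(v + P)` has a bounded second factor, and the
terms of `P²` beyond degree three are `x⁴` times a bounded factor. -/
theorem isBigO_sq_expansion (hx : Tendsto x l (𝓝 0))
    (h : (fun y => v y - (a * x y + b * x y ^ 2 + c * x y ^ 3)) =O[l] fun y => x y ^ 4) :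
    (fun y => v y ^ 2 - (a ^ 2 * x y ^ 2 + 2 * a * b * x y ^ 3)) =O[l] fun y => x y ^ 4 := by
  have hb : Tendsto (fun y => a * x y + b * x y ^ 2 + c * x y ^ 3) l (𝓝 0) := by
    simpa using ((hx.const_mul a).add ((hx.pow 2).const_mul b)).add ((hx.pow 3).const_mul c)
  have hv : Tendsto v l (𝓝 0) := by
    have h0 := h.trans_tendsto (by simpa using hx.pow 4)
    simpa using h0.add hb
  have h1 := (h.mul ((hv.add hb).isBigO_one ℝ)).congr_right fun y => mul_one _
  have h2 : (fun y => x y ^ 4 * (b ^ 2 + 2 * a * c + 2 * b * c * x y + c ^ 2 * x y ^ 2))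
      =O[l] fun y => x y ^ 4 * (1:ℝ) := (isBigO_refl _ _).mul
    (((tendsto_const_nhds.add (hx.const_mul (2 * b * c))).add
      ((hx.pow 2).const_mul (c ^ 2))).isBigO_one ℝ)
  simp only [mul_one] at h2
  refine (h1.add h2).congr_left fun y => ?_
  ring

theorem isBigO_cube_expansion (hx : Tendsto x l (𝓝 0))
    (h : (fun y => v y - (a * x y + b * x y ^ 2 + c * x y ^ 3)) =O[l] fun y => x y ^ 4) :
    (fun y => v y ^ 3 - a ^ 3 * x y ^ 3) =O[l] fun y => x y ^ 4 := by
  have h1 : (fun y => v y - a * x y) =O[l] fun y => x y ^ 2 := by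
    refine (((h.trans (isBigO_pow_of_le hx (by norm_num : 2 ≤ 4))).add
      ((isBigO_refl _ l).const_mul_left b)).add
      ((isBigO_pow_of_le hx (by norm_num : 2 ≤ 3)).const_mul_left c)).congr_left fun y => ?_
    ring
  have hxx : x =O[l] x := isBigO_refl _ _
  have hv : v =O[l] x := by
    have h2 := (h1.trans ((isBigO_pow_of_le hx (by norm_num : 1 ≤ 2)).congr_right
      fun y => pow_one (x y))).add (hxx.const_mul_left a)
    exact h2.congr_left fun y => by ring
  have h2 : (fun y => v y * v y + v y * (a * x y) + a ^ 2 * (x y * x y)) =O[l]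
      fun y => x y * x y :=
    ((hv.mul hv).add (hv.mul (hxx.const_mul_left a))).add ((hxx.mul hxx).const_mul_left _)
  refine (h1.mul h2).congr (fun y => ?_) fun y => ?_ <;> ring

/-- The polynomial in `v` is the truncated inverse power series. Its coefficients make the terms in
`x`, `x²`, `x³` cancel, leaving a linear combination of the errors in the expansions of `v`, `v²`
and `v³`. -/
theorem isBigO_inversion_three (ha : a ≠ 0) (hx : Tendsto x l (𝓝 0))
    (h : (fun y => v y - (a * x y + b * x y ^ 2 + c * x y ^ 3)) =O[l] fun y => x y ^ 4) :
    (fun y => x y - (v y / a - b / a ^ 3 * v y ^ 2 + (2 * b ^ 2 - a * c) / a ^ 5 * v y ^ 3))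
      =O[l] fun y => x y ^ 4 := by
  refine (((h.const_mul_left (-(1 / a))).add
    ((isBigO_sq_expansion hx h).const_mul_left (b / a ^ 3))).add
    ((isBigO_cube_expansion hx h).const_mul_left (-((2 * b ^ 2 - a * c) / a ^ 5)))).congr_left
    fun y => ?_
  field_simp
  ring

theorem isBigO_sq_inversion_three (ha : a ≠ 0) (hx : Tendsto x l (𝓝 0))
    (h : (fun y => v y - (a * x y + b * x y ^ 2 + c * x y ^ 3)) =O[l] fun y => x y ^ 4) :
    (fun y => x y ^ 2 - (v y ^ 2 / a ^ 2 - 2 * b / a ^ 4 * v y ^ 3)) =O[l] fun y => x y ^ 4 := by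
  refine (((isBigO_sq_expansion hx h).const_mul_left (-(1 / a ^ 2))).add
    ((isBigO_cube_expansion hx h).const_mul_left (2 * b / a ^ 4))).congr_left fun y => ?_
  field_simp
  ring

end Inversion

/-! ### Means and mean squares of the middle order statistics -/

theorem integral_orderDensity_mul_cubic (J k : ℕ) (c₁ c₂ c₃ : ℝ) :
    ∫ u in (0:ℝ)..1, orderDensity J k u
        * (c₁ * (u - 1 / 2) + c₂ * (u - 1 / 2) ^ 2 + c₃ * (u - 1 / 2) ^ 3)
      = c₁ * orderMoment J k 1 + c₂ * orderMoment J k 2 + c₃ * orderMoment J k 3 := by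
  unfold orderMoment
  have hc := continuous_orderDensity J k
  have hi : ∀ r, IntervalIntegrable (fun u => orderDensity J k u * (u - 1 / 2) ^ r) volume 0 1 :=
    fun r => Continuous.intervalIntegrable (by fun_prop) _ _
  rw [← intervalIntegral.integral_const_mul, ← intervalIntegral.integral_const_mul,
    ← intervalIntegral.integral_const_mul, ← intervalIntegral.integral_add
    ((hi 1).const_mul _) ((hi 2).const_mul _), ← intervalIntegral.integral_add
    (((hi 1).const_mul _).add ((hi 2).const_mul _)) ((hi 3).const_mul _)]
  refine intervalIntegral.integral_congr fun u _ => ?_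
  ring

section MiddleOrderStatistics
variable {μ : Measure ℝ} [IsProbabilityMeasure μ] {f : ℝ → ℝ} {m : ℝ}

theorem integrable_sub_sq_of_memLp (h : MemLp id 2 μ) (m : ℝ) :
    Integrable (fun y => (y - m) ^ 2) μ :=
  (h.sub (memLp_const m)).integrable_sq

theorem one_div_sq_le_one_div {J : ℕ} (hJ : 0 < J) : 1 / (J:ℝ) ^ 2 ≤ 1 / J := by
  have : (1:ℝ) ≤ J := by exact_mod_cast hJ
  gcongr
  nlinarith

/-- First order expansion of the mean and the mean square of the middle order statistics. -/
theorem IsDensityOf.exists_orderStatistic_first_order (hf : IsDensityOf f μ) (h2 : MemLp id 2 μ)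
    (hm : IsMedian μ m) (hpos : 0 < f m) (hd : DifferentiableAt ℝ f m) :
    ∃ D : ℝ, 0 ≤ D ∧ ∀ (J : ℕ) (k : Fin J), 2 * (k : ℕ) ≤ J → J ≤ 2 * (k : ℕ) + 2 →
      |(∫ y, (orderStatistic y k - m) ∂(Measure.pi fun _ : Fin J => μ))
        - orderMoment J k 1 / f m| ≤ D / J ∧
      ∫ y, (orderStatistic y k - m) ^ 2 ∂(Measure.pi fun _ : Fin J => μ) ≤ D / J := by
  have := hf.nullSingletonClass
  have hmc := hm.cdf_eq
  obtain ⟨δ, hδ, hinc⟩ := hf.exists_mul_sub_le_cdf_sub hd.continuousAt hpos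
  have hc : 0 < f m / 2 := by positivity
  have hsq := integrable_sub_sq_of_memLp h2 m
  have hcdf := hf.cdf_isBigO_of_differentiableAt hd hmc
  -- The zero quadratic and cubic terms bring `q` to the form evaluated by
  -- `integral_orderDensity_mul_cubic`.
  obtain ⟨η₁, hη₁, C₁, hC₁, h₁⟩ := exists_abs_sub_comp_cdf_le μ (K := 1)
    (φ := fun y => y - m) (q := fun v => 1 / f m * v + 0 * v ^ 2 + 0 * v ^ 3) (r := 2)
    hc hδ hmc hinc
    (fun y => by
      rw [one_mul, abs_le]
      constructor <;> nlinarith [sq_nonneg (y - m + 1), sq_nonneg (y - m - 1)])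
    (by fun_prop)
    ((isBigO_inversion_one hpos.ne' hcdf).congr_left fun y => by ring)
  obtain ⟨η₂, hη₂, C₂, hC₂, h₂⟩ := exists_abs_sub_comp_cdf_le μ (K := 1)
    (φ := fun y => (y - m) ^ 2) (q := fun _ => 0) (r := 2) hc hδ hmc hinc
    (fun y => by rw [one_mul, abs_of_nonneg (sq_nonneg _)]; linarith) continuous_const
    ((isBigO_refl _ _).congr_left fun y => by ring)
  obtain ⟨D₁, hD₁, e₁⟩ := exists_abs_integral_orderStatistic_sub_le μ (φ := fun y => y - m)
    (q := fun v => 1 / f m * v + 0 * v ^ 2 + 0 * v ^ 3) (r := 2) (by decide) hη₁ hC₁ hsq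
    (by fun_prop) (by fun_prop) h₁
  obtain ⟨D₂, hD₂, e₂⟩ := exists_abs_integral_orderStatistic_sub_le μ (φ := fun y => (y - m) ^ 2)
    (q := fun _ => 0) (r := 2) (by decide) hη₂ hC₂ hsq
    (by fun_prop) continuous_const h₂
  refine ⟨C₁ + D₁ + (C₂ + D₂), by positivity, fun J k hk1 hk2 => ?_⟩
  have hJ : 0 < J := (Nat.zero_le _).trans_lt k.2
  have hb := (le_abs_self _).trans (orderMoment_bounds k.2 hk1 hk2).1
  have key : ∀ C D : ℝ, 0 ≤ C → 0 ≤ D → C * orderMoment J k 2 + D / J ^ 2 ≤ (C + D) / J := by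
    intro C D hC hD
    have h3 := mul_le_mul_of_nonneg_left hb hC
    have h4 := mul_le_mul_of_nonneg_left (one_div_sq_le_one_div hJ) hD
    rw [mul_one_div] at h3 h4
    rw [mul_one_div] at h4
    rw [add_div]
    linarith
  have g₁ := e₁ J k hk1 hk2
  have g₂ := e₂ J k hk1 hk2
  have r₁ := key C₁ D₁ hC₁ hD₁
  have r₂ := key C₂ D₂ hC₂ hD₂
  have n₁ : 0 ≤ (C₁ + D₁) / J := by positivity
  have n₂ : 0 ≤ (C₂ + D₂) / J := by positivity
  rw [integral_orderDensity_mul_cubic] at g₁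
  simp only [mul_zero, intervalIntegral.integral_zero, sub_zero] at g₂
  rw [add_div]
  constructor
  · rw [zero_mul, zero_mul, add_zero, add_zero, one_div_mul_eq_div] at g₁
    linarith
  · linarith [le_abs_self (∫ y, (orderStatistic y k - m) ^ 2 ∂(Measure.pi fun _ : Fin J => μ))]

/-- Second order expansion of the mean and the mean square of the middle order statistics. -/
theorem IsDensityOf.exists_orderStatistic_second_order (hf : IsDensityOf f μ) (h2 : MemLp id 2 μ)
    (hm : IsMedian μ m) (hpos : 0 < f m) (hd : ContDiffAt ℝ 3 f m) :
    ∃ D : ℝ, 0 ≤ D ∧ ∀ (J : ℕ) (k : Fin J), 2 * (k : ℕ) ≤ J → J ≤ 2 * (k : ℕ) + 2 →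
      |(∫ y, (orderStatistic y k - m) ∂(Measure.pi fun _ : Fin J => μ))
        - (orderMoment J k 1 / f m - deriv f m / (8 * J * f m ^ 3))| ≤ D / J ^ 2 ∧
      |∫ y, (orderStatistic y k - m) ^ 2 ∂(Measure.pi fun _ : Fin J => μ)
        - 1 / (4 * J * f m ^ 2)| ≤ D / J ^ 2 := by
  have := hf.nullSingletonClass
  have hmc := hm.cdf_eq
  obtain ⟨δ, hδ, hinc⟩ := hf.exists_mul_sub_le_cdf_sub hd.continuousAt hpos
  have hc : 0 < f m / 2 := by positivity
  have hsq := integrable_sub_sq_of_memLp h2 m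
  obtain ⟨γ, hcdf⟩ := hf.cdf_isBigO_of_contDiffAt hd hmc
  have hx : Tendsto (fun y => y - m) (𝓝 m) (𝓝 0) := by
    simpa using (tendsto_id (α := ℝ) (x := 𝓝 m)).sub_const m
  set a := f m with ha
  set b := deriv f m / 2 with hb'
  set κ := (2 * b ^ 2 - a * γ) / a ^ 5
  obtain ⟨η₁, hη₁, C₁, hC₁, h₁⟩ := exists_abs_sub_comp_cdf_le μ (K := 1)
    (φ := fun y => y - m) (q := fun v => 1 / a * v + -(b / a ^ 3) * v ^ 2 + κ * v ^ 3) (r := 4)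
    hc hδ hmc hinc
    (fun y => by
      rw [one_mul, abs_le]
      constructor <;> nlinarith [sq_nonneg (y - m + 1), sq_nonneg (y - m - 1)])
    (by fun_prop)
    ((isBigO_inversion_three hpos.ne' hx hcdf).congr_left fun y => by ring)
  obtain ⟨η₂, hη₂, C₂, hC₂, h₂⟩ := exists_abs_sub_comp_cdf_le μ (K := 1)
    (φ := fun y => (y - m) ^ 2)
    (q := fun v => 0 * v + 1 / a ^ 2 * v ^ 2 + -(2 * b / a ^ 4) * v ^ 3) (r := 4) hc hδ hmc hinc
    (fun y => by rw [one_mul, abs_of_nonneg (sq_nonneg _)]; linarith) (by fun_prop)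
    ((isBigO_sq_inversion_three hpos.ne' hx hcdf).congr_left fun y => by ring)
  obtain ⟨D₁, hD₁, e₁⟩ := exists_abs_integral_orderStatistic_sub_le μ (φ := fun y => y - m)
    (q := fun v => 1 / a * v + -(b / a ^ 3) * v ^ 2 + κ * v ^ 3) (r := 4) (by decide) hη₁ hC₁ hsq
    (by fun_prop) (by fun_prop) h₁
  obtain ⟨D₂, hD₂, e₂⟩ := exists_abs_integral_orderStatistic_sub_le μ (φ := fun y => (y - m) ^ 2)
    (q := fun v => 0 * v + 1 / a ^ 2 * v ^ 2 + -(2 * b / a ^ 4) * v ^ 3) (r := 4) (by decide) hη₂ hC₂ hsq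
    (by fun_prop) (by fun_prop) h₂
  refine ⟨C₁ + D₁ + |b / a ^ 3| + |κ| + (C₂ + D₂ + |1 / a ^ 2| + |2 * b / a ^ 4|), by positivity,
    fun J k hk1 hk2 => ?_⟩
  have hJ : (0:ℝ) < J := by exact_mod_cast (Nat.zero_le _).trans_lt k.2
  obtain ⟨-, b2, b3, b4⟩ := orderMoment_bounds k.2 hk1 hk2
  have b4 := (le_abs_self _).trans b4
  have g₁ := e₁ J k hk1 hk2
  have g₂ := e₂ J k hk1 hk2
  rw [integral_orderDensity_mul_cubic] at g₁ g₂
  set I₁ := ∫ y, (orderStatistic y k - m) ∂(Measure.pi fun _ : Fin J => μ)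
  set I₂ := ∫ y, (orderStatistic y k - m) ^ 2 ∂(Measure.pi fun _ : Fin J => μ)
  set M₁ := orderMoment J k 1
  set M₂ := orderMoment J k 2
  set M₃ := orderMoment J k 3
  have t4 : ∀ C : ℝ, 0 ≤ C → C * orderMoment J k 4 ≤ C / J ^ 2 := fun C hC => by
    have := mul_le_mul_of_nonneg_left b4 hC
    rwa [mul_one_div] at this
  have t : ∀ (C M : ℝ), |M| ≤ 1 / (J:ℝ) ^ 2 → |C * M| ≤ |C| / J ^ 2 := fun C M hM => by
    have := mul_le_mul_of_nonneg_left hM (abs_nonneg C)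
    rwa [mul_one_div, ← abs_mul] at this
  have s₁ := t (b / a ^ 3) _ b2
  have s₂ := t κ _ b3
  have s₃ := t (1 / a ^ 2) _ b2
  have s₄ := t (2 * b / a ^ 4) _ b3
  have u₁ := t4 C₁ hC₁
  have u₂ := t4 C₂ hC₂
  have pos : ∀ c : ℝ, 0 ≤ c → 0 ≤ c / (J:ℝ) ^ 2 := fun c hc => by positivity
  have p₁ := pos _ hC₁
  have p₂ := pos _ hC₂
  have p₃ := pos _ hD₁
  have p₄ := pos _ hD₂
  have p₅ := pos _ (abs_nonneg (b / a ^ 3))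
  have p₆ := pos _ (abs_nonneg κ)
  have p₇ := pos _ (abs_nonneg (1 / a ^ 2))
  have p₈ := pos _ (abs_nonneg (2 * b / a ^ 4))
  -- The bias term appears here: `b / a³` times `1/(4J)` is `f'(m)/(8 J a³)`, since `b = f'(m)/2`.
  have d₁ : I₁ - (M₁ / a - deriv f m / (8 * J * a ^ 3))
      = (I₁ - (1 / a * M₁ + -(b / a ^ 3) * M₂ + κ * M₃))
        - b / a ^ 3 * (M₂ - 1 / (4 * J)) + κ * M₃ := by
    rw [hb']
    field_simp
    ring
  have d₂ : I₂ - 1 / (4 * J * a ^ 2)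
      = (I₂ - (0 * M₁ + 1 / a ^ 2 * M₂ + -(2 * b / a ^ 4) * M₃))
        + 1 / a ^ 2 * (M₂ - 1 / (4 * J)) - 2 * b / a ^ 4 * M₃ := by
    field_simp
    ring
  simp only [add_div]
  rw [d₁, d₂]
  constructor
  · have := abs_add_le ((I₁ - (1 / a * M₁ + -(b / a ^ 3) * M₂ + κ * M₃))
        - b / a ^ 3 * (M₂ - 1 / (4 * J))) (κ * M₃)
    have := abs_sub (I₁ - (1 / a * M₁ + -(b / a ^ 3) * M₂ + κ * M₃))
      (b / a ^ 3 * (M₂ - 1 / (4 * J)))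
    linarith
  · have := abs_sub ((I₂ - (0 * M₁ + 1 / a ^ 2 * M₂ + -(2 * b / a ^ 4) * M₃))
        + 1 / a ^ 2 * (M₂ - 1 / (4 * J))) (2 * b / a ^ 4 * M₃)
    have := abs_add_le (I₂ - (0 * M₁ + 1 / a ^ 2 * M₂ + -(2 * b / a ^ 4) * M₃))
      (1 / a ^ 2 * (M₂ - 1 / (4 * J)))
    linarith

end MiddleOrderStatistics

/-! ### The sample median under the product measure -/

section SampleMedian
variable {μ : Measure ℝ} [IsProbabilityMeasure μ] {f : ℝ → ℝ} {m : ℝ}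

theorem memLp_sampleMedian [NullSingletonClass μ] (h2 : MemLp id 2 μ) {J : ℕ} (hJ : 1 ≤ J) :
    MemLp (fun y => sampleMedian y) 2 (Measure.pi fun _ : Fin J => μ) := by
  have h := fun k : Fin J => memLp_orderStatistic μ k h2 measurable_id
  have := ((h ⟨(J - 1) / 2, by omega⟩).add (h ⟨J / 2, by omega⟩)).const_mul (1 / 2)
  convert this using 2 with y
  simp only [sampleMedian, dif_pos (show 0 < J from hJ)]
  simp
  ring

/-- The mean of the sample median through the means of the two middle order statistics. -/
theorem integral_sampleMedian_sub [NullSingletonClass μ] (h2 : MemLp id 2 μ) {J : ℕ}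
    (hJ : 1 ≤ J) (m : ℝ) :
    (∫ y, sampleMedian y ∂(Measure.pi fun _ : Fin J => μ)) - m
      = ((∫ y, (orderStatistic y ⟨(J - 1) / 2, by omega⟩ - m) ∂(Measure.pi fun _ : Fin J => μ))
        + ∫ y, (orderStatistic y ⟨J / 2, by omega⟩ - m) ∂(Measure.pi fun _ : Fin J => μ)) / 2 := by
  have hi : ∀ k : Fin J, Integrable (fun y => orderStatistic y k)
      (Measure.pi fun _ : Fin J => μ) := fun k =>
    (memLp_orderStatistic μ k h2 measurable_id).integrable one_le_two
  simp only [sampleMedian, dif_pos (show 0 < J from hJ)]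
  rw [integral_div, integral_add (hi _) (hi _), integral_sub (hi _) (integrable_const _),
    integral_sub (hi _) (integrable_const _)]
  simp
  ring

/-- The variance of the sample median through second moments of the two middle order statistics. -/
theorem variance_sampleMedian [NullSingletonClass μ] (h2 : MemLp id 2 μ) {J : ℕ}
    (hJ : 1 ≤ J) (m : ℝ) :
    variance (fun y => sampleMedian y) (Measure.pi fun _ : Fin J => μ)
      = ((∫ y, (orderStatistic y ⟨(J - 1) / 2, by omega⟩ - m) ^ 2
            ∂(Measure.pi fun _ : Fin J => μ))
          + ∫ y, (orderStatistic y ⟨J / 2, by omega⟩ - m) ^ 2 ∂(Measure.pi fun _ : Fin J => μ)) / 2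
        - (∫ y, (orderStatistic y ⟨J / 2, by omega⟩ - orderStatistic y ⟨(J - 1) / 2, by omega⟩) ^ 2
            ∂(Measure.pi fun _ : Fin J => μ)) / 4
        - ((∫ y, sampleMedian y ∂(Measure.pi fun _ : Fin J => μ)) - m) ^ 2 := by
  set ν := Measure.pi fun _ : Fin J => μ
  set k : Fin J := ⟨(J - 1) / 2, by omega⟩
  set l : Fin J := ⟨J / 2, by omega⟩
  have hL : ∀ k : Fin J, MemLp (fun y => orderStatistic y k) 2 ν := fun k =>
    memLp_orderStatistic μ k h2 measurable_id
  have hT := memLp_sampleMedian h2 hJ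
  have hk : Integrable (fun y => (orderStatistic y k - m) ^ 2) ν :=
    ((hL k).sub (memLp_const m)).integrable_sq
  have hl : Integrable (fun y => (orderStatistic y l - m) ^ 2) ν :=
    ((hL l).sub (memLp_const m)).integrable_sq
  have hs : Integrable (fun y => (orderStatistic y l - orderStatistic y k) ^ 2) ν :=
    ((hL l).sub (hL k)).integrable_sq
  have hTm : MemLp (fun y => sampleMedian y - m) 2 ν := hT.sub (memLp_const m)
  rw [← variance_sub_const hT.1 m, variance_eq_sub hTm,
    integral_sub (hT.integrable one_le_two) (integrable_const _)]
  -- The parallelogram identity for the two middle values centred at `m`. For odd `J` they coincide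
  -- and the gap term vanishes.
  have e : ∀ y : Fin J → ℝ, ((fun y => sampleMedian y - m) ^ 2) y
      = ((orderStatistic y k - m) ^ 2 + (orderStatistic y l - m) ^ 2) / 2
        - (orderStatistic y l - orderStatistic y k) ^ 2 / 4 := by
    intro y
    simp only [Pi.pow_apply, sampleMedian, dif_pos (show 0 < J from hJ)]
    ring
  simp_rw [e]
  have hkl : Integrable (fun y =>
      ((orderStatistic y k - m) ^ 2 + (orderStatistic y l - m) ^ 2) / 2) ν :=
    (hk.add hl).div_const 2
  rw [integral_sub hkl (hs.div_const 4), integral_div, integral_div,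
    integral_add hk hl]
  simp
  rfl

/-- The two middle indices add up to `J - 1`, so they lie symmetrically about the centre. For even
`J` each first moment is itself of order `1/J`; only this cancellation keeps them out of the bias.
-/
theorem orderMoment_one_add_orderMoment_one {J : ℕ} (hJ : 1 ≤ J) :
    orderMoment J ((J - 1) / 2) 1 + orderMoment J (J / 2) 1 = 0 := by
  rw [orderMoment_one (by omega), orderMoment_one (by omega), ← add_div, div_eq_zero_iff]
  left
  have h : (J - 1) / 2 + J / 2 + 1 = J := by omega
  have h' : (((J - 1) / 2 : ℕ) : ℝ) + ((J / 2 : ℕ) : ℝ) + 1 = J := by exact_mod_cast h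
  linarith

theorem IsDensityOf.exists_sampleMedian_first_order (hf : IsDensityOf f μ) (h2 : MemLp id 2 μ)
    (hm : IsMedian μ m) (hpos : 0 < f m) (hd : DifferentiableAt ℝ f m) :
    ∃ D : ℝ, 0 ≤ D ∧ ∀ J : ℕ, 1 ≤ J →
      |(∫ y, sampleMedian y ∂(Measure.pi fun _ : Fin J => μ)) - m| ≤ D / J ∧
      variance (fun y => sampleMedian y) (Measure.pi fun _ : Fin J => μ) ≤ D / J := by
  have := hf.nullSingletonClass
  obtain ⟨D, hD0, hD⟩ := hf.exists_orderStatistic_first_order h2 hm hpos hd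
  refine ⟨D, hD0, fun J hJ => ?_⟩
  have hk := hD J ⟨(J - 1) / 2, by omega⟩ (by simp only; omega) (by simp only; omega)
  have hl := hD J ⟨J / 2, by omega⟩ (by simp only; omega) (by simp only; omega)
  have h0 := orderMoment_one_add_orderMoment_one hJ
  rw [variance_sampleMedian h2 hJ m, integral_sampleMedian_sub h2 hJ m]
  simp only at hk hl
  constructor
  · have h1 := abs_le.1 hk.1
    have h2 := abs_le.1 hl.1
    have h3 : orderMoment J ((J - 1) / 2) 1 / f m + orderMoment J (J / 2) 1 / f m = 0 := by
      rw [← add_div, h0, zero_div]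
    rw [abs_le]
    constructor <;> linarith [h1.1, h1.2, h2.1, h2.2]
  -- The squared gap and the squared bias enter the variance with a minus sign, so an upper bound
  -- may drop them.
  · have : 0 ≤ ∫ y, (orderStatistic y ⟨J / 2, by omega⟩
        - orderStatistic y ⟨(J - 1) / 2, by omega⟩) ^ 2 ∂(Measure.pi fun _ : Fin J => μ) :=
      integral_nonneg fun _ => sq_nonneg _
    linarith [hk.2, hl.2, sq_nonneg (((∫ y, (orderStatistic y ⟨(J - 1) / 2, by omega⟩ - m)
      ∂(Measure.pi fun _ : Fin J => μ)) + ∫ y, (orderStatistic y ⟨J / 2, by omega⟩ - m)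
      ∂(Measure.pi fun _ : Fin J => μ)) / 2)]

theorem IsDensityOf.exists_sampleMedian_second_order (hf : IsDensityOf f μ) (h2 : MemLp id 2 μ)
    (hm : IsMedian μ m) (hpos : 0 < f m) (hd : ContDiffAt ℝ 3 f m) :
    ∃ D : ℝ, 0 ≤ D ∧ ∀ J : ℕ, 1 ≤ J →
      |(∫ y, sampleMedian y ∂(Measure.pi fun _ : Fin J => μ))
        - (m - deriv f m / (8 * J * f m ^ 3))| ≤ D / J ^ 2 ∧
      |variance (fun y => sampleMedian y) (Measure.pi fun _ : Fin J => μ)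
        - 1 / (4 * J * f m ^ 2)| ≤ D / J ^ 2 := by
  have := hf.nullSingletonClass
  obtain ⟨δ, hδ, hinc⟩ := hf.exists_mul_sub_le_cdf_sub hd.continuousAt hpos
  obtain ⟨D₁, hD₁, h₁⟩ := hf.exists_sampleMedian_first_order h2 hm hpos
    (hd.differentiableAt (by norm_num))
  obtain ⟨D₂, hD₂, h₂⟩ := hf.exists_orderStatistic_second_order h2 hm hpos hd
  obtain ⟨D₃, hD₃, h₃⟩ := exists_integral_sq_orderStatistic_sub_le μ (half_pos hpos) hδ hm.cdf_eq
    hinc (integrable_sub_sq_of_memLp h2 m)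
  -- `D₂` comes from the two middle order statistics, `D₃` from their squared gap, `D₁ ^ 2` from the
  -- squared bias.
  refine ⟨D₂ + D₃ + D₁ ^ 2, by positivity, fun J hJ => ?_⟩
  have hJ0 : (0:ℝ) < J := by exact_mod_cast hJ
  have hk := h₂ J ⟨(J - 1) / 2, by omega⟩ (by simp only; omega) (by simp only; omega)
  have hl := h₂ J ⟨J / 2, by omega⟩ (by simp only; omega) (by simp only; omega)
  have h0 := orderMoment_one_add_orderMoment_one hJ
  have hb := (h₁ J hJ).1
  have hs : ∫ y, (orderStatistic y ⟨J / 2, by omega⟩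
        - orderStatistic y ⟨(J - 1) / 2, by omega⟩) ^ 2 ∂(Measure.pi fun _ : Fin J => μ)
      ≤ D₃ / J ^ 2 := by
    by_cases hodd : J / 2 = (J - 1) / 2
    · simp only [hodd, sub_self, ne_eq, OfNat.ofNat_ne_zero, not_false_eq_true, zero_pow,
        integral_zero]
      positivity
    · exact h₃ J ⟨(J - 1) / 2, by omega⟩ ⟨J / 2, by omega⟩ (by simp only; omega)
        (by simp only; omega) (by simp only; omega) (by simp only; omega) (by simp only; omega)
  have hs0 : 0 ≤ ∫ y, (orderStatistic y ⟨J / 2, by omega⟩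
        - orderStatistic y ⟨(J - 1) / 2, by omega⟩) ^ 2 ∂(Measure.pi fun _ : Fin J => μ) :=
      integral_nonneg fun _ => sq_nonneg _
  have hb2 : ((∫ y, sampleMedian y ∂(Measure.pi fun _ : Fin J => μ)) - m) ^ 2
      ≤ D₁ ^ 2 / J ^ 2 := by
    rw [← div_pow, ← sq_abs]; gcongr
  have hp₁ : 0 ≤ D₁ ^ 2 / (J:ℝ) ^ 2 := by positivity
  have hp₂ : 0 ≤ D₃ / (J:ℝ) ^ 2 := by positivity
  simp only at hk hl
  have hk1 := abs_le.1 hk.1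
  have hk2 := abs_le.1 hk.2
  have hl1 := abs_le.1 hl.1
  have hl2 := abs_le.1 hl.2
  simp only [add_div]
  constructor
  · have h3 : orderMoment J ((J - 1) / 2) 1 / f m + orderMoment J (J / 2) 1 / f m = 0 := by
      rw [← add_div, h0, zero_div]
    have h4 := integral_sampleMedian_sub h2 hJ m
    rw [abs_le]
    constructor <;> linarith [hk1.1, hk1.2, hl1.1, hl1.2]
  · rw [variance_sampleMedian h2 hJ m, abs_le]
    have := sq_nonneg ((∫ y, sampleMedian y ∂(Measure.pi fun _ : Fin J => μ)) - m)
    constructor <;> linarith [hk2.1, hk2.2, hl2.1, hl2.2]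

end SampleMedian

/-! ### Transfer to iid random variables -/

section Estimator
variable {Ω : Type*} [MeasurableSpace Ω] {P : Measure Ω}
  {Y : ℕ → Ω → ℝ} {f : ℝ → ℝ} {m : ℝ}

theorem map_sample_eq_pi [IsProbabilityMeasure P] (hY : iIndepFun Y P) (hid : ∀ j, IdentDistrib (Y j) (Y 0) P P) (J : ℕ) :
    P.map (fun ω (j : Fin J) => Y j ω) = Measure.pi fun _ : Fin J => P.map (Y 0) := by
  have h := (iIndepFun_iff_map_fun_eq_pi_map (f := fun j : Fin J => Y j)
    fun j => (hid j).aemeasurable_fst).1 (hY.precomp Fin.val_injective)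
  rw [h]
  congr 1
  ext1 j
  exact (hid j).map_eq

theorem aemeasurable_sample (hid : ∀ j, IdentDistrib (Y j) (Y 0) P P) (J : ℕ) :
    AEMeasurable (fun ω (j : Fin J) => Y j ω) P :=
  aemeasurable_pi_lambda _ fun j => (hid j).aemeasurable_fst

theorem integral_medianEstimator [IsProbabilityMeasure P] (hY : iIndepFun Y P) (hid : ∀ j, IdentDistrib (Y j) (Y 0) P P)
    (J : ℕ) : ∫ ω, medianEstimator Y J ω ∂P
      = ∫ y, sampleMedian y ∂(Measure.pi fun _ : Fin J => P.map (Y 0)) := by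
  rw [← map_sample_eq_pi hY hid, integral_map (aemeasurable_sample hid J)
    measurable_sampleMedian.aestronglyMeasurable]
  rfl

theorem variance_medianEstimator [IsProbabilityMeasure P] (hY : iIndepFun Y P) (hid : ∀ j, IdentDistrib (Y j) (Y 0) P P)
    (J : ℕ) : variance (medianEstimator Y J) P
      = variance (fun y => sampleMedian y) (Measure.pi fun _ : Fin J => P.map (Y 0)) := by
  rw [← map_sample_eq_pi hY hid, variance_map measurable_sampleMedian.aemeasurable
    (aemeasurable_sample hid J)]
  rfl

theorem memLp_id_map (hid : ∀ j, IdentDistrib (Y j) (Y 0) P P) (h2 : MemLp (Y 0) 2 P) :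
    MemLp id 2 (P.map (Y 0)) :=
  (memLp_map_measure_iff aestronglyMeasurable_id (hid 0).aemeasurable_fst).2 h2

theorem firstOrderBiasVariance_medianEstimator [IsProbabilityMeasure P] (hY : iIndepFun Y P)
    (hid : ∀ j, IdentDistrib (Y j) (Y 0) P P) (h2 : MemLp (Y 0) 2 P)
    (hm : IsMedian (P.map (Y 0)) m) (hf : IsDensityOf f (P.map (Y 0))) (hpos : 0 < f m)
    (hd : DifferentiableAt ℝ f m) : FirstOrderBiasVariance P (medianEstimator Y) m := by
  have := Measure.isProbabilityMeasure_map (hid 0).aemeasurable_fst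
  have := hf.nullSingletonClass
  have h2' := memLp_id_map hid h2
  obtain ⟨D, hD0, hD⟩ := hf.exists_sampleMedian_first_order h2' hm hpos hd
  refine ⟨fun J hJ => ?_, IsBigO.of_bound D ?_, IsBigO.of_bound D ?_⟩
  · have h := memLp_sampleMedian h2' hJ
    rw [← map_sample_eq_pi hY hid, memLp_map_measure_iff
      measurable_sampleMedian.aestronglyMeasurable (aemeasurable_sample hid J)] at h
    exact h
  · filter_upwards [eventually_ge_atTop 1] with J hJ
    rw [integral_medianEstimator hY hid, Real.norm_eq_abs, Real.norm_of_nonneg (by positivity),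
      mul_one_div]
    exact (hD J hJ).1
  · filter_upwards [eventually_ge_atTop 1] with J hJ
    rw [variance_medianEstimator hY hid, Real.norm_of_nonneg (variance_nonneg _ _),
      Real.norm_of_nonneg (by positivity), mul_one_div]
    exact (hD J hJ).2

theorem secondOrderBiasVariance_medianEstimator [IsProbabilityMeasure P] (hY : iIndepFun Y P)
    (hid : ∀ j, IdentDistrib (Y j) (Y 0) P P) (h2 : MemLp (Y 0) 2 P)
    (hm : IsMedian (P.map (Y 0)) m) (hf : IsDensityOf f (P.map (Y 0))) (hpos : 0 < f m)
    (hd : ContDiffAt ℝ 3 f m) : SecondOrderBiasVariance P (medianEstimator Y) f m := by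
  have := Measure.isProbabilityMeasure_map (hid 0).aemeasurable_fst
  obtain ⟨D, hD0, hD⟩ := hf.exists_sampleMedian_second_order (memLp_id_map hid h2) hm hpos hd
  refine ⟨IsBigO.of_bound D ?_, IsBigO.of_bound D ?_⟩
  · filter_upwards [eventually_ge_atTop 1] with J hJ
    rw [integral_medianEstimator hY hid, Real.norm_eq_abs, Real.norm_of_nonneg (by positivity),
      mul_one_div]
    exact (hD J hJ).1
  · filter_upwards [eventually_ge_atTop 1] with J hJ
    rw [variance_medianEstimator hY hid, Real.norm_eq_abs, Real.norm_of_nonneg (by positivity),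
      mul_one_div]
    exact (hD J hJ).2

end Estimator

/-! ### Gamma variables: change of rate and scaling -/

theorem pi_withDensity_ofReal {ι : Type*} [Fintype ι] (μ : ι → Measure ℝ)
    [∀ i, SigmaFinite (μ i)] {f : ι → ℝ → ℝ} (h0 : ∀ i x, 0 ≤ f i x)
    (hi : ∀ i, Integrable (f i) (μ i)) :
    Measure.pi (fun i => (μ i).withDensity fun x => ENNReal.ofReal (f i x))
      = (Measure.pi μ).withDensity fun x => ENNReal.ofReal (∏ i, f i (x i)) := by
  have : ∀ i, IsFiniteMeasure ((μ i).withDensity fun x => ENNReal.ofReal (f i x)) := fun i =>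
    isFiniteMeasure_withDensity_ofReal (hi i).2
  refine Measure.pi_eq fun s hs => ?_
  rw [withDensity_apply _ (MeasurableSet.univ_pi hs), Measure.restrict_pi_pi,
    ← ofReal_integral_eq_lintegral_ofReal
      (Integrable.fintype_prod fun i => (hi i).restrict)
      (.of_forall fun x => Finset.prod_nonneg fun i _ => h0 i _),
    integral_fintype_prod_eq_prod, ENNReal.ofReal_prod_of_nonneg
      fun i _ => integral_nonneg (h0 i)]
  refine Finset.prod_congr rfl fun i _ => ?_
  rw [withDensity_apply _ (hs i), ofReal_integral_eq_lintegral_ofReal (hi i).restrict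
    (.of_forall (h0 i))]

section Gamma
variable {α r r' : ℝ}

/-- Exponential tilting: on the half-line, gamma densities of the same shape differ by a constant
times an exponential. -/
theorem gammaMeasure_eq_withDensity_gammaMeasure (hα : 0 < α) (hr : 0 < r) (hr' : 0 < r') :
    gammaMeasure α r' = (gammaMeasure α r).withDensity
      fun x => ENNReal.ofReal ((r' / r) ^ α * Real.exp (-((r' - r) * x))) := by
  have hm : Measurable (gammaPDF α r) := (measurable_gammaPDFReal α r).ennreal_ofReal
  have hm' : Measurable fun x : ℝ =>
      ENNReal.ofReal ((r' / r) ^ α * Real.exp (-((r' - r) * x))) := by fun_prop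
  unfold gammaMeasure
  rw [← withDensity_mul _ hm hm']
  congr 1
  ext1 x
  simp only [Pi.mul_apply, gammaPDF]
  rw [← ENNReal.ofReal_mul (gammaPDFReal_nonneg hα hr x)]
  congr 1
  unfold gammaPDFReal
  split_ifs
  · have e : Real.exp (-(r' * x)) = Real.exp (-(r * x)) * Real.exp (-((r' - r) * x)) := by
      rw [← Real.exp_add]; congr 1; ring
    rw [e, Real.div_rpow hr'.le hr.le]
    have := (Real.rpow_pos_of_pos hr α).ne'
    field_simp
  · simp

theorem integrable_exp_mul_gammaMeasure (hα : 0 < α) (hr : 0 < r) (hr' : 0 < r') :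
    Integrable (fun x => (r' / r) ^ α * Real.exp (-((r' - r) * x))) (gammaMeasure α r) := by
  have := isProbabilityMeasure_gammaMeasure hα hr'
  refine ⟨by fun_prop, ?_⟩
  rw [hasFiniteIntegral_iff_ofReal (.of_forall fun x => by positivity), ← setLIntegral_univ,
    ← withDensity_apply _ MeasurableSet.univ,
    ← gammaMeasure_eq_withDensity_gammaMeasure hα hr hr']
  exact measure_lt_top _ _

/-- Up to a constant this is the density of the gamma law of rate `r - t` relative to that of rate
`r`. -/
theorem integrable_exp_gammaMeasure (hα : 0 < α) (hr : 0 < r) {t : ℝ} (ht : t < r) :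
    Integrable (fun x => Real.exp (t * x)) (gammaMeasure α r) := by
  have h := (integrable_exp_mul_gammaMeasure hα hr (sub_pos.2 ht)).const_mul
    (((r - t) / r) ^ α)⁻¹
  have hne : ((r - t) / r) ^ α ≠ 0 := (Real.rpow_pos_of_pos (div_pos (sub_pos.2 ht) hr) α).ne'
  refine h.congr (.of_forall fun x => ?_)
  simp only
  rw [inv_mul_cancel_left₀ hne]
  congr 1
  ring

theorem map_mul_gammaMeasure (hα : 0 < α) (hr : 0 < r) {c : ℝ} (hc : 0 < c) :
    (gammaMeasure α r).map (fun x => c * x) = gammaMeasure α (r / c) := by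
  have hm : Measurable (gammaPDF α (r / c)) := (measurable_gammaPDFReal α _).ennreal_ofReal
  ext s hs
  have hcm : Measurable fun x : ℝ => c * x := measurable_const_mul c
  rw [Measure.map_apply hcm hs]
  unfold gammaMeasure
  rw [withDensity_apply _ (hcm hs), withDensity_apply _ hs]
  have e : ∀ x, gammaPDF α r x = ENNReal.ofReal c * gammaPDF α (r / c) (c * x) := by
    intro x
    unfold gammaPDF
    rw [← ENNReal.ofReal_mul hc.le]
    congr 1
    unfold gammaPDFReal
    by_cases hx : 0 ≤ x
    · have hcx : 0 ≤ c * x := by positivity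
      rw [if_pos hx, if_pos hcx, Real.div_rpow hr.le hc.le, Real.mul_rpow hc.le hx,
        Real.rpow_sub_one hc.ne']
      have := (Real.rpow_pos_of_pos hc α).ne'
      have e2 : r / c * (c * x) = r * x := by field_simp
      rw [e2]
      field_simp
    · have hcx : ¬ 0 ≤ c * x := by
        rw [not_le] at hx ⊢
        exact mul_neg_of_pos_of_neg hc hx
      simp [if_neg hx, if_neg hcx]
  simp_rw [e]
  rw [lintegral_const_mul' _ _ ENNReal.ofReal_ne_top, ← setLIntegral_map hs hm hcm,
    Real.map_volume_mul_left hc.ne', Measure.restrict_smul, lintegral_smul_measure, smul_eq_mul,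
    ← mul_assoc, ← ENNReal.ofReal_mul hc.le, abs_of_pos (inv_pos.2 hc), mul_inv_cancel₀ hc.ne',
    ENNReal.ofReal_one, one_mul]

theorem gammaMeasure_absolutelyContinuous : gammaMeasure α r ≪ volume :=
  withDensity_absolutelyContinuous _ _

theorem ae_pos_gammaMeasure : ∀ᵐ x ∂gammaMeasure α r, 0 < x := by
  have h : gammaMeasure α r (Set.Iic 0) = 0 := by
    rw [← measure_congr (gammaMeasure_absolutelyContinuous.ae_eq Iio_ae_eq_Iic), gammaMeasure,
      withDensity_apply _ measurableSet_Iio, lintegral_gammaPDF_of_nonpos le_rfl]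
  rw [ae_iff]
  simpa [Set.Iic] using h

theorem ae_forall_pos_pi_gammaMeasure {ι : Type*} [Fintype ι] (hα : 0 < α) {ρ : ι → ℝ}
    (hρ : ∀ i, 0 < ρ i) :
    ∀ᵐ g ∂(Measure.pi fun i => gammaMeasure α (ρ i)), ∀ i, 0 < g i := by
  have := fun i => isProbabilityMeasure_gammaMeasure hα (hρ i)
  rw [ae_all_iff]
  intro i
  exact (Measure.tendsto_eval_ae_ae (μ := fun i => gammaMeasure α (ρ i)) (i := i)).eventually
    ae_pos_gammaMeasure

theorem pi_gammaMeasure_eq_withDensity {ι : Type*} [Fintype ι] (hα : 0 < α) {ρ ρ' : ι → ℝ}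
    (hρ : ∀ i, 0 < ρ i) (hρ' : ∀ i, 0 < ρ' i) :
    Measure.pi (fun i => gammaMeasure α (ρ' i))
      = (Measure.pi fun i => gammaMeasure α (ρ i)).withDensity fun x =>
        ENNReal.ofReal (∏ i, ((ρ' i / ρ i) ^ α * Real.exp (-((ρ' i - ρ i) * x i)))) := by
  have := fun i => isProbabilityMeasure_gammaMeasure hα (hρ i)
  rw [← pi_withDensity_ofReal (fun i => gammaMeasure α (ρ i))
    (f := fun i x => (ρ' i / ρ i) ^ α * Real.exp (-((ρ' i - ρ i) * x)))
    (fun i x => mul_nonneg (Real.rpow_nonneg (div_pos (hρ' i) (hρ i)).le _) (Real.exp_nonneg _))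
    fun i => integrable_exp_mul_gammaMeasure hα (hρ i) (hρ' i)]
  congr 1
  ext1 i
  exact gammaMeasure_eq_withDensity_gammaMeasure hα (hρ i) (hρ' i)

/-- The probability of a set under independent gamma variables, as a function of the rates. -/
theorem pi_gammaMeasure_real_eq {ι : Type*} [Fintype ι] (hα : 0 < α) {ρ ρ' : ι → ℝ}
    (hρ : ∀ i, 0 < ρ i) (hρ' : ∀ i, 0 < ρ' i) {K : Set (ι → ℝ)} (hK : MeasurableSet K) :
    (Measure.pi fun i => gammaMeasure α (ρ' i)).real K
      = (∏ i, (ρ' i / ρ i) ^ α) * ∫ x in K, Real.exp (-∑ i, (ρ' i - ρ i) * x i)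
        ∂(Measure.pi fun i => gammaMeasure α (ρ i)) := by
  rw [measureReal_def, pi_gammaMeasure_eq_withDensity hα hρ hρ', withDensity_apply _ hK,
    ← integral_const_mul, ← integral_toReal]
  · refine integral_congr_ae (.of_forall fun x => ?_)
    simp only
    rw [ENNReal.toReal_ofReal (Finset.prod_nonneg fun i _ => mul_nonneg
      (Real.rpow_nonneg (div_pos (hρ' i) (hρ i)).le _) (Real.exp_nonneg _)),
      Finset.prod_mul_distrib, ← Finset.sum_neg_distrib, Real.exp_sum]
  · exact (Measurable.ennreal_ofReal (by fun_prop)).aemeasurable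
  · exact .of_forall fun x => ENNReal.ofReal_lt_top

end Gamma

/-! ### Analyticity of gamma probabilities in the shift -/

/-- Complex differentiation under the integral sign on a ball where the exponents stay below `η` and
their derivatives below `M`. One factor `exp (η ∑ |x i|)` dominates the integrand and a second one
absorbs the linear factor produced by the derivative; hence the `2 * η` in the integrability
hypothesis. -/
theorem analyticAt_integral_cexp_neg_sum {ι : Type*} [Fintype ι] {ν : Measure (ι → ℝ)}
    {R : ι → ℂ → ℂ} {z₀ : ℂ} {η : ℝ} (hη : 0 < η) (hR : ∀ i, AnalyticAt ℂ (R i) z₀)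
    (hR0 : ∀ i, R i z₀ = 0) (hν : Integrable (fun x => Real.exp (2 * η * ∑ i, |x i|)) ν) :
    AnalyticAt ℂ (fun z => ∫ x, Complex.exp (-∑ i, R i z * (x i : ℂ)) ∂ν) z₀ := by
  set M : ℝ := ∑ i, (‖deriv (R i) z₀‖ + 1) with hM
  have hev : ∀ᶠ z in 𝓝 z₀, ∀ i, DifferentiableAt ℂ (R i) z ∧ ‖R i z‖ ≤ η ∧
      ‖deriv (R i) z‖ ≤ M := by
    rw [eventually_all]
    intro i
    have h1 := (hR i).eventually_analyticAt
    have h2 : ∀ᶠ z in 𝓝 z₀, ‖R i z‖ < η :=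
      (hR i).continuousAt.norm.eventually_lt_const (by simpa [hR0] using hη)
    have h3 : ∀ᶠ z in 𝓝 z₀, ‖deriv (R i) z‖ < ‖deriv (R i) z₀‖ + 1 :=
      (hR i).deriv.continuousAt.norm.eventually_lt_const (lt_add_one _)
    have hi : ‖deriv (R i) z₀‖ + 1 ≤ M :=
      Finset.single_le_sum (f := fun i => ‖deriv (R i) z₀‖ + 1)
        (fun i _ => by positivity) (Finset.mem_univ i)
    filter_upwards [h1, h2, h3] with z g1 g2 g3
    exact ⟨g1.differentiableAt, g2.le, g3.le.trans hi⟩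
  obtain ⟨ε, hε, hball⟩ := Metric.eventually_nhds_iff_ball.1 hev
  have hM0 : 0 ≤ M := Finset.sum_nonneg fun i _ => by positivity
  have hexp : ∀ z ∈ Metric.ball z₀ ε, ∀ x : ι → ℝ,
      ‖Complex.exp (-∑ i, R i z * (x i : ℂ))‖ ≤ Real.exp (η * ∑ i, |x i|) := by
    intro z hz x
    rw [Complex.norm_exp]
    refine Real.exp_le_exp.2 ((Complex.re_le_norm _).trans ?_)
    rw [norm_neg, Finset.mul_sum]
    refine (norm_sum_le _ _).trans (Finset.sum_le_sum fun i _ => ?_)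
    rw [norm_mul, Complex.norm_real, Real.norm_eq_abs]
    exact mul_le_mul_of_nonneg_right ((hball z hz i).2.1) (abs_nonneg _)
  have hcont : ∀ z, Continuous fun x : ι → ℝ => Complex.exp (-∑ i, R i z * (x i : ℂ)) := by
    intro z
    fun_prop
  refine DifferentiableOn.analyticAt (s := Metric.ball z₀ ε) (fun z hz => ?_)
    (Metric.ball_mem_nhds z₀ hε)
  refine DifferentiableAt.differentiableWithinAt (HasDerivAt.differentiableAt
    (hasDerivAt_integral_of_dominated_loc_of_deriv_le (s := Metric.ball z₀ ε)
      (F' := fun z x => Complex.exp (-∑ i, R i z * (x i : ℂ))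
        * -∑ i, deriv (R i) z * (x i : ℂ))
      (bound := fun x => M / η * Real.exp (2 * η * ∑ i, |x i|))
      (Metric.isOpen_ball.mem_nhds hz) (.of_forall fun z => (hcont z).aestronglyMeasurable)
      ?_ ?_ (.of_forall fun x w hw => ?_) (hν.const_mul _) (.of_forall fun x w hw => ?_)).2)
  · refine hν.mono' (hcont z).aestronglyMeasurable (.of_forall fun x => (hexp z hz x).trans ?_)
    have : 0 ≤ ∑ i, |x i| := Finset.sum_nonneg fun i _ => abs_nonneg _
    exact Real.exp_le_exp.2 (by nlinarith)
  · exact Continuous.aestronglyMeasurable (by fun_prop)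
  · have hS : 0 ≤ ∑ i, |x i| := Finset.sum_nonneg fun i _ => abs_nonneg _
    have h1 : ‖-∑ i, deriv (R i) w * (x i : ℂ)‖ ≤ M * ∑ i, |x i| := by
      rw [norm_neg, Finset.mul_sum]
      refine (norm_sum_le _ _).trans (Finset.sum_le_sum fun i _ => ?_)
      rw [norm_mul, Complex.norm_real, Real.norm_eq_abs]
      exact mul_le_mul_of_nonneg_right ((hball w hw i).2.2) (abs_nonneg _)
    have h2 : ∑ i, |x i| ≤ Real.exp (η * ∑ i, |x i|) / η := by
      rw [le_div_iff₀ hη]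
      linarith [Real.add_one_le_exp (η * ∑ i, |x i|)]
    rw [norm_mul]
    calc _ ≤ Real.exp (η * ∑ i, |x i|) * (M * (Real.exp (η * ∑ i, |x i|) / η)) :=
          mul_le_mul (hexp w hw x) (h1.trans (by gcongr)) (norm_nonneg _) (Real.exp_nonneg _)
      _ = M / η * Real.exp (2 * η * ∑ i, |x i|) := by
          rw [show 2 * η * ∑ i, |x i| = η * ∑ i, |x i| + η * ∑ i, |x i| by ring, Real.exp_add]
          ring
  · have h : HasDerivAt (fun z => -∑ i, R i z * (x i : ℂ))
        (-∑ i, deriv (R i) w * (x i : ℂ)) w :=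
      (HasDerivAt.fun_sum fun i _ => (hball w hw i).1.hasDerivAt.mul_const _).neg
    exact h.cexp

theorem map_pi_mul_gammaMeasure {ι : Type*} [Fintype ι] {α : ℝ} (hα : 0 < α) {c : ι → ℝ}
    (hc : ∀ i, 0 < c i) :
    (Measure.pi fun _ : ι => gammaMeasure α 1).map (fun g i => c i * g i)
      = Measure.pi fun i => gammaMeasure α (1 / c i) := by
  have := isProbabilityMeasure_gammaMeasure hα one_pos
  have h : ∀ i, (gammaMeasure α 1).map (fun x => c i * x) = gammaMeasure α (1 / c i) := fun i =>
    map_mul_gammaMeasure hα one_pos (hc i)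
  have h' : ∀ i, SigmaFinite ((gammaMeasure α 1).map fun x => c i * x) := fun i => by
    rw [h]
    have := isProbabilityMeasure_gammaMeasure hα (one_div_pos.2 (hc i))
    infer_instance
  refine (Measure.pi_map_pi (μ := fun _ : ι => gammaMeasure α 1) (f := fun i x => c i * x)
    fun i => (measurable_const_mul (c i)).aemeasurable).trans ?_
  simp_rw [h]

theorem measurableSet_sum_mul_le {ι : Type*} [Fintype ι] (c : ι → ℝ) (t : ℝ) :
    MeasurableSet {x : ι → ℝ | ∑ i, x i * c i ≤ t} :=
  measurableSet_le (by fun_prop) measurable_const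

/-- The probability that a linear combination of independent gamma variables is nonpositive is an
analytic function of a common shift of the coefficients, where none of these vanishes. -/
theorem analyticAt_pi_gammaMeasure_real {ι : Type*} [Fintype ι] {α : ℝ} (hα : 0 < α)
    {θ : ι → ℝ} {t : ℝ} (ht : ∀ i, θ i ≠ t) :
    AnalyticAt ℝ (fun s => (Measure.pi fun _ : ι => gammaMeasure α 1).real
      {g | ∑ i, g i * (θ i - s) ≤ 0}) t := by
  -- With the signs of `θ i - t`, the scalings `σ i * (θ i - s)` are positive for `s` near `t`.
  -- Rescaling by them turns the event into the fixed cone `K`, and `s` survives only in the rates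
  -- `ρ i s`.
  set σ : ι → ℝ := fun i => if t < θ i then 1 else -1 with hσ
  have hσσ : ∀ i, σ i * σ i = 1 := fun i => by
    simp only [hσ]; split_ifs <;> norm_num
  have hσ0 : ∀ i, σ i ≠ 0 := fun i h => by simpa [h] using hσσ i
  have ht0 : ∀ i, 0 < σ i * (θ i - t) := fun i => by
    simp only [hσ]
    split_ifs with h
    · linarith
    · have := lt_of_le_of_ne (not_lt.1 h) (ht i)
      linarith
  have hev : ∀ᶠ s in 𝓝 t, ∀ i, 0 < σ i * (θ i - s) :=
    eventually_all.2 fun i => Tendsto.eventually_const_lt (ht0 i)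
      (Continuous.tendsto (f := fun s => σ i * (θ i - s)) (by fun_prop) t)
  set ρ : ι → ℝ → ℝ := fun i s => 1 / (σ i * (θ i - s)) with hρ
  have hρ0 : ∀ i, 0 < ρ i t := fun i => one_div_pos.2 (ht0 i)
  set K : Set (ι → ℝ) := {x | ∑ i, x i * σ i ≤ 0} with hK
  have hKm : MeasurableSet K := measurableSet_sum_mul_le σ 0
  set ν := (Measure.pi fun i => gammaMeasure α (ρ i t)).restrict K with hν
  have hprob := fun i => isProbabilityMeasure_gammaMeasure hα (hρ0 i)
  -- Small enough for the gamma laws of rates `ρ i t` to have exponential moments of order `2 * η`.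
  obtain ⟨η, hηρ, hη⟩ : ∃ η, (∀ i, 2 * η < ρ i t) ∧ 0 < η := by
    have h1 : ∀ᶠ η in 𝓝[>] (0:ℝ), ∀ i, 2 * η < ρ i t :=
      eventually_all.2 fun i => nhdsWithin_le_nhds
        (Tendsto.eventually_lt_const (by simpa using hρ0 i)
          (Continuous.tendsto (f := fun η : ℝ => 2 * η) (by fun_prop) 0))
    exact (h1.and self_mem_nhdsWithin).exists
  have hint : Integrable (fun x : ι → ℝ => Real.exp (2 * η * ∑ i, |x i|)) ν := by
    refine Integrable.restrict ?_
    have h := Integrable.fintype_prod (μ := fun i => gammaMeasure α (ρ i t))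
      fun i => integrable_exp_gammaMeasure hα (hρ0 i) (hηρ i)
    refine h.congr ?_
    filter_upwards [ae_forall_pos_pi_gammaMeasure hα hρ0] with x hx
    rw [← Real.exp_sum, ← Finset.mul_sum]
    congr 2
    exact Finset.sum_congr rfl fun i _ => (abs_of_pos (hx i)).symm
  -- The complex extension of the rate difference `ρ i s - ρ i t`, which is the exponent of the
  -- tilting.
  set R : ι → ℂ → ℂ := fun i z => 1 / (σ i * (θ i - z)) - ρ i t with hR
  have hRa : ∀ i, AnalyticAt ℂ (R i) t := fun i => by
    have : (σ i : ℂ) * (θ i - t) ≠ 0 := by exact_mod_cast (ht0 i).ne'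
    fun_prop (disch := assumption)
  have hR0 : ∀ i, R i t = 0 := fun i => by
    simp [hR, hρ]
  have hI := (analyticAt_integral_cexp_neg_sum hη hRa hR0 hint).re_ofReal
  have hP : AnalyticAt ℝ (fun s => ∏ i, Real.exp (Real.log (ρ i s / ρ i t) * α)) t := by
    refine Finset.analyticAt_fun_prod _ fun i _ => ?_
    have h1 : AnalyticAt ℝ (fun s => ρ i s / ρ i t) t := by
      have := (ht0 i).ne'
      have := (hρ0 i).ne'
      simp only [hρ] at this ⊢
      fun_prop (disch := assumption)
    have h2 : 0 < ρ i t / ρ i t := div_pos (hρ0 i) (hρ0 i)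
    exact ((h1.log h2).mul analyticAt_const).rexp'
  refine (hP.mul hI).congr ?_
  filter_upwards [hev] with s hs
  have hρs : ∀ i, 0 < ρ i s := fun i => one_div_pos.2 (hs i)
  have e1 : (Measure.pi fun _ : ι => gammaMeasure α 1).real {g | ∑ i, g i * (θ i - s) ≤ 0}
      = (Measure.pi fun i => gammaMeasure α (ρ i s)).real K := by
    simp only [hρ]
    rw [← map_pi_mul_gammaMeasure hα hs, map_measureReal_apply (by fun_prop) hKm]
    congr 1
    ext g
    have : ∀ i, g i * (θ i - s) = σ i * (θ i - s) * g i * σ i := fun i => by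
      linear_combination (-(g i * (θ i - s))) * hσσ i
    simp only [Set.mem_ofPred_eq, Set.mem_preimage, hK, this]
  rw [e1, pi_gammaMeasure_real_eq hα hρ0 hρs hKm]
  simp only [Pi.mul_apply]
  congr 1
  · refine Finset.prod_congr rfl fun i _ => ?_
    rw [Real.rpow_def_of_pos (div_pos (hρs i) (hρ0 i))]
  · have : ∀ x : ι → ℝ, Complex.exp (-∑ i, R i s * (x i : ℂ))
        = ((Real.exp (-∑ i, (ρ i s - ρ i t) * x i) : ℝ) : ℂ) := fun x => by
      simp only [hR, hρ]
      push_cast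
      rfl
    simp_rw [this]
    rw [integral_complex_ofReal, Complex.ofReal_re]

/-! ### The law of a Dirichlet mean -/

theorem measurable_weightedMean {n : ℕ} (θ : Fin n → ℝ) : Measurable (weightedMean θ) := by
  unfold weightedMean
  fun_prop

theorem measurable_normalize {n : ℕ} : Measurable fun (g : Fin n → ℝ) i => g i / ∑ k, g k := by
  fun_prop

theorem weightedMean_normalize {n : ℕ} (θ g : Fin n → ℝ) :
    weightedMean θ (fun i => g i / ∑ k, g k) = (∑ i, g i * θ i) / ∑ k, g k := by
  unfold weightedMean
  rw [Finset.sum_div]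
  exact Finset.sum_congr rfl fun i _ => by ring

/-- The law of a mean of fixed numbers with symmetric Dirichlet weights. -/
noncomputable def dirichletMeanLaw {n : ℕ} (α : ℝ) (θ : Fin n → ℝ) : Measure ℝ :=
  (dirichletMeasure fun _ : Fin n => α).map (weightedMean θ)

section DirichletMean
variable {n : ℕ} {α : ℝ} {θ : Fin n → ℝ} {m : ℝ}

theorem dirichletMeanLaw_eq_map (α : ℝ) (θ : Fin n → ℝ) :
    dirichletMeanLaw α θ = (Measure.pi fun _ : Fin n => gammaMeasure α 1).map
      fun g => (∑ i, g i * θ i) / ∑ k, g k := by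
  unfold dirichletMeanLaw dirichletMeasure
  rw [Measure.map_map (measurable_weightedMean θ) measurable_normalize]
  congr 1
  ext1 g
  exact weightedMean_normalize θ g

theorem isProbabilityMeasure_dirichletMeanLaw (hα : 0 < α) (θ : Fin n → ℝ) :
    IsProbabilityMeasure (dirichletMeanLaw α θ) := by
  have := isProbabilityMeasure_gammaMeasure hα one_pos
  rw [dirichletMeanLaw_eq_map]
  exact Measure.isProbabilityMeasure_map (Measurable.aemeasurable (by fun_prop))

theorem sum_mul_sub_eq (g : Fin n → ℝ) (t : ℝ) :
    ∑ i, g i * (θ i - t) = (∑ i, g i * θ i) - t * ∑ k, g k := by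
  rw [Finset.mul_sum, ← Finset.sum_sub_distrib]
  exact Finset.sum_congr rfl fun i _ => by ring

theorem ae_forall_pos_gamma (n : ℕ) (hα : 0 < α) :
    ∀ᵐ g ∂(Measure.pi fun _ : Fin n => gammaMeasure α 1), ∀ i, 0 < g i :=
  ae_forall_pos_pi_gammaMeasure hα fun _ => one_pos

theorem sum_pos_of_pos (hn : 0 < n) {g : Fin n → ℝ} (hg : ∀ i, 0 < g i) : 0 < ∑ k, g k :=
  Finset.sum_pos (fun i _ => hg i) ⟨⟨0, hn⟩, Finset.mem_univ _⟩

/-- The normalising sum is almost surely positive. Multiplying by it makes the event linear in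
independent gamma variables. -/
theorem cdf_dirichletMeanLaw (hn : 0 < n) (hα : 0 < α) (t : ℝ) :
    cdf (dirichletMeanLaw α θ) t = (Measure.pi fun _ : Fin n => gammaMeasure α 1).real
      {g | ∑ i, g i * (θ i - t) ≤ 0} := by
  have := isProbabilityMeasure_dirichletMeanLaw hα θ
  rw [cdf_eq_real, dirichletMeanLaw_eq_map,
    map_measureReal_apply (by fun_prop) measurableSet_Iic]
  refine measureReal_congr ?_
  filter_upwards [ae_forall_pos_gamma n hα] with g hg
  refine propext ?_
  change (∑ i, g i * θ i) / ∑ k, g k ≤ t ↔ ∑ i, g i * (θ i - t) ≤ 0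
  rw [div_le_iff₀ (sum_pos_of_pos hn hg), sum_mul_sub_eq, sub_nonpos]

theorem analyticAt_cdf_dirichletMeanLaw (hn : 0 < n) (hα : 0 < α) {t : ℝ} (ht : ∀ i, θ i ≠ t) :
    AnalyticAt ℝ (cdf (dirichletMeanLaw α θ)) t :=
  (analyticAt_pi_gammaMeasure_real hα ht).congr
    (.of_forall fun s => (cdf_dirichletMeanLaw hn hα s).symm)

theorem pi_gammaMeasure_absolutelyContinuous (n : ℕ) (hα : 0 < α) :
    (Measure.pi fun _ : Fin n => gammaMeasure α 1) ≪ volume := by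
  have hi : Integrable (gammaPDFReal α 1) := by
    have := isProbabilityMeasure_gammaMeasure hα one_pos
    refine ⟨(measurable_gammaPDFReal α 1).aestronglyMeasurable, ?_⟩
    rw [hasFiniteIntegral_iff_ofReal (.of_forall (gammaPDFReal_nonneg hα one_pos))]
    exact (lintegral_gammaPDF_eq_one hα one_pos).trans_lt ENNReal.one_lt_top
  have h := pi_withDensity_ofReal (ι := Fin n) (fun _ => volume)
    (f := fun _ => gammaPDFReal α 1) (fun _ => gammaPDFReal_nonneg hα one_pos) fun _ => hi
  have h' : (Measure.pi fun _ : Fin n => gammaMeasure α 1) = _ := h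
  rw [h', volume_pi]
  exact withDensity_absolutelyContinuous _ _

/-- An atom at `t` would charge the hyperplane `∑ g i (θ i - t) = 0`. This is a proper subspace
because some `θ i ≠ t`, and the gamma product is absolutely continuous. -/
theorem nullSingletonClass_dirichletMeanLaw (hn : 0 < n) (hα : 0 < α)
    (hθ : ∀ t, ∃ i, θ i ≠ t) : NullSingletonClass (dirichletMeanLaw α θ) where
  measure_singleton t := by
    rw [dirichletMeanLaw_eq_map, Measure.map_apply (by fun_prop) (measurableSet_singleton t)]
    obtain ⟨i, hi⟩ := hθ t
    set L : (Fin n → ℝ) →ₗ[ℝ] ℝ := Fintype.linearCombination ℝ fun i => θ i - t with hL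
    have hLg : ∀ g, L g = ∑ i, g i * (θ i - t) := fun g => by
      simp [hL, Fintype.linearCombination_apply]
    have hne : LinearMap.ker L ≠ ⊤ := by
      intro h
      have h1 : Pi.single i 1 ∈ LinearMap.ker L := by rw [h]; trivial
      rw [LinearMap.mem_ker, hLg] at h1
      simp [Pi.single_apply, sub_eq_zero] at h1
      exact hi h1
    have h0 := pi_gammaMeasure_absolutelyContinuous n hα
      (Measure.addHaar_submodule volume (LinearMap.ker L) hne)
    refine measure_mono_null_ae ?_ h0
    filter_upwards [ae_forall_pos_gamma n hα] with g hg hgt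
    have hgt' : (∑ i, g i * θ i) / ∑ k, g k = t := hgt
    have hS := sum_pos_of_pos hn hg
    rw [div_eq_iff hS.ne'] at hgt'
    change L g = 0
    rw [hLg, sum_mul_sub_eq, hgt', sub_self]

/-- A continuous distribution function which is differentiable off a finite set has its derivative
as a density. -/
theorem isDensityOf_deriv_cdf {μ : Measure ℝ} [IsProbabilityMeasure μ] [NullSingletonClass μ]
    {s : Set ℝ} (hs : s.Finite) (hd : ∀ x ∉ s, DifferentiableAt ℝ (cdf μ) x) :
    IsDensityOf (deriv (cdf μ)) μ := by
  have hmono := monotone_cdf μ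
  have h0 : ∀ x, 0 ≤ deriv (cdf μ) x := fun x => hmono.deriv_nonneg
  refine ⟨measurable_deriv _, h0, ?_⟩
  refine Measure.ext_of_Ioc _ _ fun a b hab => ?_
  -- Monotonicity alone makes the derivative integrable, so its possible blow-up at the points of
  -- `s` does no harm.
  have hi : IntervalIntegrable (deriv (cdf μ)) volume a b :=
    (hmono.monotoneOn _).intervalIntegrable_deriv
  rw [withDensity_apply _ measurableSet_Ioc, ← ofReal_integral_eq_lintegral_ofReal
    ((intervalIntegrable_iff_integrableOn_Ioc_of_le hab.le).1 hi) (.of_forall h0),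
    ← intervalIntegral.integral_of_le hab.le,
    integral_eq_of_hasDerivAt_off_countable_of_le (cdf μ) (deriv (cdf μ)) hab.le hs.countable
      (continuous_cdf μ).continuousOn (fun x hx => (hd x hx.2).hasDerivAt) hi,
    ← (cdf μ).measure_Ioc, measure_cdf]

end DirichletMean

/-! ### Positivity of the density at the median -/

theorem exists_gammaPDFReal_ge {α a b : ℝ} (hα : 0 < α) (ha : 0 < a) :
    ∃ c > 0, ∀ x ∈ Set.Icc a b, c ≤ gammaPDFReal α 1 x := by
  rcases lt_or_ge b a with hab | hab
  · exact ⟨1, one_pos, fun x hx => absurd (hx.1.trans hx.2) (not_le.2 hab)⟩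
  have hc : ContinuousOn (gammaPDFReal α 1) (Set.Icc a b) := by
    have h : ContinuousOn (fun x : ℝ => 1 ^ α / Real.Gamma α * x ^ (α - 1) * Real.exp (-(1 * x)))
        (Set.Icc a b) := by
      refine ContinuousOn.mul (continuousOn_const.mul (continuousOn_id.rpow_const fun x hx => ?_))
        (by fun_prop)
      exact Or.inl (ha.trans_le hx.1).ne'
    refine h.congr fun x hx => ?_
    rw [gammaPDFReal, if_pos (ha.le.trans hx.1)]
  obtain ⟨x₀, hx₀, hmin⟩ := isCompact_Icc.exists_isMinOn (Set.nonempty_Icc.2 hab) hc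
  exact ⟨_, gammaPDFReal_pos hα one_pos (ha.trans_le hx₀.1), fun x hx => hmin hx⟩

theorem ofReal_mul_sub_le_gammaMeasure_Ioc {α c u v : ℝ} (hc : 0 ≤ c)
    (h : ∀ x ∈ Set.Ioc u v, c ≤ gammaPDFReal α 1 x) :
    ENNReal.ofReal (c * (v - u)) ≤ gammaMeasure α 1 (Set.Ioc u v) := by
  rw [gammaMeasure, withDensity_apply _ measurableSet_Ioc, ENNReal.ofReal_mul hc,
    ← Real.volume_Ioc, ← setLIntegral_const]
  exact setLIntegral_mono' measurableSet_Ioc fun x hx => ENNReal.ofReal_le_ofReal (h x hx)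

section DirichletMean
variable {n : ℕ} {α m : ℝ}

theorem exists_lt_of_cdf_dirichletMeanLaw_lt_one {θ : Fin n → ℝ} (hn : 0 < n) (hα : 0 < α)
    (hF : cdf (dirichletMeanLaw α θ) m < 1) : ∃ i, m < θ i := by
  have := isProbabilityMeasure_gammaMeasure hα one_pos
  by_contra! h
  refine hF.ne ?_
  rw [cdf_dirichletMeanLaw hn hα]
  refine (measureReal_congr ?_).trans
    (probReal_univ (μ := Measure.pi fun _ : Fin n => gammaMeasure α 1))
  filter_upwards [ae_forall_pos_gamma n hα] with g hg
  refine propext (iff_of_true ?_ trivial)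
  exact Finset.sum_nonpos fun i _ =>
    mul_nonpos_of_nonneg_of_nonpos (hg i).le (sub_nonpos.2 (h i))

/-- Separating one of the gamma variables: the others are such that the distribution of the mean
puts a mass of exact order `h` in `(m, m + h]`. -/
theorem exists_mul_le_cdf_dirichletMeanLaw_sub {θ : Fin (n + 1) → ℝ} (hα : 0 < α)
    (hF0 : 0 < cdf (dirichletMeanLaw α θ) m) (hF1 : cdf (dirichletMeanLaw α θ) m < 1) :
    ∃ C > 0, ∀ h > 0, h ≤ 1 →
      C * h ≤ cdf (dirichletMeanLaw α θ) (m + h) - cdf (dirichletMeanLaw α θ) m := by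
  obtain ⟨i₀, hi₀⟩ := exists_lt_of_cdf_dirichletMeanLaw_lt_one n.succ_pos hα hF1
  have hΓ := isProbabilityMeasure_gammaMeasure hα one_pos
  have hlaw := isProbabilityMeasure_dirichletMeanLaw hα θ
  set d := θ i₀ - m with hd
  have hd0 : 0 < d := sub_pos.2 hi₀
  set Γ := gammaMeasure α 1 with hΓdef
  set π := Measure.pi fun _ : Fin (n + 1) => Γ with hπ
  set π' := Measure.pi fun _ : Fin n => Γ with hπ'
  -- With `x = g i₀`, the mean exceeds `m` exactly when `x d > W`, and it is at most `m + h` exactly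
  -- when `x d - W ≤ h (x + S)`.
  set W : (Fin n → ℝ) → ℝ := fun w => ∑ j, w j * (m - θ (i₀.succAbove j)) with hW
  set S : (Fin n → ℝ) → ℝ := fun w => ∑ j, w j with hS
  have hWm : Measurable W := by fun_prop
  have hSm : Measurable S := by fun_prop
  set e : (Fin (n + 1) → ℝ) → ℝ × (Fin n → ℝ) := fun g => (g i₀, fun j => g (i₀.succAbove j))
  have he : ∀ A, MeasurableSet A → π (e ⁻¹' A) = (Γ.prod π') A := fun A hA =>
    (measurePreserving_piFinSuccAbove (fun _ : Fin (n + 1) => Γ) i₀).measure_preimage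
      hA.nullMeasurableSet
  have hsum : ∀ g : Fin (n + 1) → ℝ, ∑ i, g i * (θ i - m) = (e g).1 * d - W (e g).2 := by
    intro g
    have hneg : -W (e g).2 = ∑ j, (e g).2 j * (θ (i₀.succAbove j) - m) := by
      simp only [hW, ← Finset.sum_neg_distrib]
      exact Finset.sum_congr rfl fun j _ => by ring
    rw [Fin.sum_univ_succAbove _ i₀, sub_eq_add_neg ((e g).1 * d), hneg]
  have hsumS : ∀ g : Fin (n + 1) → ℝ, ∑ i, g i = (e g).1 + S (e g).2 := fun g =>
    Fin.sum_univ_succAbove _ i₀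
  have hpos := ae_forall_pos_gamma (n + 1) hα
  -- These sets exhaust `W > 0`, `S > 0`. If all were null, the mean would almost surely exceed `m`,
  -- against `F m > 0`.
  set E : ℕ → Set (Fin n → ℝ) := fun N =>
    {w | (1 / ((N:ℝ) + 1) ≤ W w ∧ W w ≤ N + 1) ∧ 1 / ((N:ℝ) + 1) ≤ S w} with hE
  have hEm : ∀ N, MeasurableSet (E N) := fun N =>
    ((measurableSet_le measurable_const hWm).inter (measurableSet_le hWm measurable_const)).inter
      (measurableSet_le measurable_const hSm)
  obtain ⟨N, hN⟩ : ∃ N, 0 < π' (E N) := by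
    refine exists_measure_pos_of_not_measure_iUnion_null fun h0 => ?_
    have hB : π (e ⁻¹' (Set.univ ×ˢ ⋃ N, E N)) = 0 := by
      rw [he _ (MeasurableSet.univ.prod (MeasurableSet.iUnion hEm)), Measure.prod_prod, h0,
        mul_zero]
    have h1 : π {g | ∑ i, g i * (θ i - m) ≤ 0} = 0 := by
      refine measure_mono_null_ae ?_ hB
      filter_upwards [hpos] with g hg hle
      have hle' : ∑ i, g i * (θ i - m) ≤ 0 := hle
      rw [hsum] at hle'
      have hx : 0 < (e g).1 := hg i₀
      have hw : 0 < W (e g).2 := by nlinarith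
      -- `S = 0` would force `W = 0`. This argument also covers `n = 0`, where both sums are empty.
      have hs : 0 < S (e g).2 := by
        refine (Finset.sum_nonneg fun j _ => (hg _).le).lt_of_ne fun h => hw.ne' ?_
        have hz := (Finset.sum_eq_zero_iff_of_nonneg fun j _ => (hg (i₀.succAbove j)).le).1 h.symm
        exact Finset.sum_eq_zero fun j hj => by
          have : (e g).2 j = 0 := hz j hj
          rw [this, zero_mul]
      obtain ⟨N₁, hN₁⟩ := exists_nat_one_div_lt (lt_min hw hs)
      obtain ⟨N₂, hN₂⟩ := exists_nat_gt (W (e g).2)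
      refine ⟨trivial, Set.mem_iUnion.2 ⟨max N₁ N₂, ?_⟩⟩
      have hle1 : 1 / (((max N₁ N₂ : ℕ) : ℝ) + 1) ≤ 1 / ((N₁ : ℝ) + 1) := by
        gcongr; exact le_max_left _ _
      have hle2 : (N₂ : ℝ) ≤ ((max N₁ N₂ : ℕ) : ℝ) := by exact_mod_cast le_max_right _ _
      refine ⟨⟨?_, by linarith⟩, ?_⟩
      · linarith [min_le_left (W (e g).2) (S (e g).2)]
      · linarith [min_le_right (W (e g).2) (S (e g).2)]
    rw [cdf_dirichletMeanLaw n.succ_pos hα, measureReal_def, h1] at hF0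
    simp at hF0
  set δ : ℝ := 1 / ((N:ℝ) + 1) with hδ
  have hδ0 : 0 < δ := by positivity
  -- For `h ≤ 1` and `w ∈ E N` the interval used for `x` lies in `[δ / d, (N + 1 + δ) / d]`, away
  -- from `0`, so the gamma density is bounded below on it.
  obtain ⟨c, hc, hcd⟩ := exists_gammaPDFReal_ge (b := ((N:ℝ) + 1 + δ) / d) hα (div_pos hδ0 hd0)
  refine ⟨c * (δ / d) * π'.real (E N), ?_, fun h hh hh1 => ?_⟩
  · have : 0 < π'.real (E N) := ENNReal.toReal_pos hN.ne' (measure_ne_top _ _)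
    positivity
  -- Given the other variables, `x` ranges over an interval of length `h δ / d` just above `W / d`.
  -- Since `S ≥ δ`, this keeps the mean in `(m, m + h]`.
  set A : Set (ℝ × (Fin n → ℝ)) :=
    {z | (W z.2 / d < z.1 ∧ z.1 ≤ (W z.2 + h * δ) / d) ∧ z.2 ∈ E N} with hA
  have hAm : MeasurableSet A :=
    ((measurableSet_lt ((hWm.comp measurable_snd).div_const _) measurable_fst).inter
      (measurableSet_le measurable_fst
        (((hWm.comp measurable_snd).add_const _).div_const _))).inter (measurable_snd (hEm N))
  have hAle : ENNReal.ofReal (c * (δ / d) * h) * π' (E N) ≤ (Γ.prod π') A := by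
    rw [Measure.prod_apply_symm hAm, ← setLIntegral_const, ← lintegral_indicator (hEm N)]
    refine lintegral_mono fun w => ?_
    by_cases hw : w ∈ E N
    · rw [Set.indicator_of_mem hw]
      have hset : (fun x => (x, w)) ⁻¹' A = Set.Ioc (W w / d) ((W w + h * δ) / d) := by
        ext x
        exact ⟨fun hx => hx.1, fun hx => ⟨hx, hw⟩⟩
      rw [hset]
      refine le_trans (le_of_eq ?_) (ofReal_mul_sub_le_gammaMeasure_Ioc hc.le fun x hx =>
        hcd x ⟨?_, ?_⟩)
      · congr 1
        ring
      · exact (div_le_div_of_nonneg_right hw.1.1 hd0.le).trans hx.1.le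
      · refine hx.2.trans (div_le_div_of_nonneg_right ?_ hd0.le)
        have := hw.1.2
        nlinarith
    · rw [Set.indicator_of_notMem hw]
      exact zero_le
  have hlow : (Γ.prod π') A ≤ dirichletMeanLaw α θ (Set.Ioc m (m + h)) := by
    rw [dirichletMeanLaw_eq_map, Measure.map_apply (by fun_prop) measurableSet_Ioc, ← he A hAm]
    refine measure_mono_ae ?_
    filter_upwards [hpos] with g hg hgA
    obtain ⟨⟨h1, h2⟩, h3⟩ := hgA
    have hx : 0 < (e g).1 := hg i₀
    have hSg := sum_pos_of_pos n.succ_pos hg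
    have hs := sum_mul_sub_eq (θ := θ) g m
    rw [hsum] at hs
    rw [div_lt_iff₀ hd0] at h1
    rw [le_div_iff₀ hd0] at h2
    have h4 : δ ≤ S (e g).2 := h3.2
    change m < (∑ i, g i * θ i) / ∑ k, g k ∧ (∑ i, g i * θ i) / ∑ k, g k ≤ m + h
    rw [lt_div_iff₀ hSg, div_le_iff₀ hSg]
    have h5 := hsumS g
    constructor
    · linarith
    · have h6 : h * δ ≤ h * S (e g).2 := by gcongr
      have h7 : 0 < h * (e g).1 := by positivity
      rw [add_mul]
      nlinarith
  have hfin := hAle.trans hlow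
  rw [← measure_cdf (dirichletMeanLaw α θ), (cdf (dirichletMeanLaw α θ)).measure_Ioc,
    ← ofReal_measureReal, ← ENNReal.ofReal_mul (by positivity)] at hfin
  have := (ENNReal.ofReal_le_ofReal_iff (sub_nonneg.2
    (monotone_cdf (dirichletMeanLaw α θ) (by linarith)))).1 hfin
  linarith

/-- The derivative exists by analyticity and is the limit of right difference quotients, all at
least `C`. -/
theorem deriv_cdf_dirichletMeanLaw_pos {θ : Fin n → ℝ} (hn : 0 < n) (hα : 0 < α)
    (hF0 : 0 < cdf (dirichletMeanLaw α θ) m) (hF1 : cdf (dirichletMeanLaw α θ) m < 1)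
    (hm : ∀ i, θ i ≠ m) : 0 < deriv (cdf (dirichletMeanLaw α θ)) m := by
  obtain ⟨n, rfl⟩ : ∃ k, n = k + 1 := ⟨n - 1, by omega⟩
  obtain ⟨C, hC, h⟩ := exists_mul_le_cdf_dirichletMeanLaw_sub hα hF0 hF1
  refine hC.trans_le ?_
  have hd := (analyticAt_cdf_dirichletMeanLaw hn hα hm).differentiableAt.hasDerivAt
  refine ge_of_tendsto hd.tendsto_slope_zero_right ?_
  filter_upwards [Ioc_mem_nhdsGT (zero_lt_one (α := ℝ))] with t ht
  rw [smul_eq_mul, inv_mul_eq_div, le_div_iff₀ ht.1]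
  exact h t ht.1 ht.2

theorem dirichletMeanLaw_const (hn : 0 < n) (hα : 0 < α) (t : ℝ) :
    dirichletMeanLaw α (fun _ : Fin n => t) = Measure.dirac t := by
  have := isProbabilityMeasure_gammaMeasure hα one_pos
  rw [dirichletMeanLaw_eq_map]
  have h : (fun g : Fin n → ℝ => (∑ i, g i * t) / ∑ k, g k)
      =ᵐ[Measure.pi fun _ : Fin n => gammaMeasure α 1] fun _ => t := by
    filter_upwards [ae_forall_pos_gamma n hα] with g hg
    rw [← Finset.sum_mul, mul_div_assoc, mul_div_cancel₀ _ (sum_pos_of_pos hn hg).ne']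
  rw [Measure.map_congr h, Measure.map_const, measure_univ, one_smul]

theorem isMedian_dirac (t : ℝ) : IsMedian (Measure.dirac t) t := by
  constructor <;> simp

/-- If all estimates were equal to `t`, the law would be the Dirac mass at `t`, whose median `t` is
one of the estimates. -/
theorem exists_ne_of_isUniqueMedian {θ : Fin n → ℝ} (hn : 0 < n) (hα : 0 < α)
    (h : IsUniqueMedian (dirichletMeanLaw α θ) m) (hm : ∀ i, m ≠ θ i) (t : ℝ) :
    ∃ i, θ i ≠ t := by
  by_contra! ht
  obtain rfl : θ = fun _ => t := funext ht
  rw [dirichletMeanLaw_const hn hα] at h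
  exact hm ⟨0, hn⟩ (h.2 t (isMedian_dirac t)).symm

/-- A convex combination of the `θ i` is bounded by `∑ |θ i|`. -/
theorem memLp_id_dirichletMeanLaw (hn : 0 < n) (hα : 0 < α) (θ : Fin n → ℝ) :
    MemLp id 2 (dirichletMeanLaw α θ) := by
  have := isProbabilityMeasure_dirichletMeanLaw hα θ
  refine MemLp.of_bound aestronglyMeasurable_id (∑ i, |θ i|) ?_
  rw [dirichletMeanLaw_eq_map, ae_map_iff (Measurable.aemeasurable (by fun_prop))
    (measurableSet_le (by fun_prop) measurable_const)]
  filter_upwards [ae_forall_pos_gamma n hα] with g hg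
  have hS := sum_pos_of_pos hn hg
  rw [id, Real.norm_eq_abs, abs_div, abs_of_pos hS, div_le_iff₀ hS, Finset.sum_mul]
  refine (Finset.abs_sum_le_sum_abs _ _).trans (Finset.sum_le_sum fun i _ => ?_)
  rw [abs_mul, abs_of_pos (hg i), mul_comm]
  exact mul_le_mul_of_nonneg_left
    (Finset.single_le_sum (fun j _ => (hg j).le) (Finset.mem_univ i)) (abs_nonneg _)

end DirichletMean

/-! ### The Bayesian median of means and the conclusion -/

/-- The bias and the variance of the Bayesian median of means. -/
theorem bayesianMedianOfMeans_biasVariance {Ω : Type*} [MeasurableSpace Ω] {P : Measure Ω}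
    [IsProbabilityMeasure P] {n : ℕ} {α : ℝ} {θ : Fin n → ℝ} {p : ℕ → Ω → Fin n → ℝ} {m : ℝ}
    (hn : 0 < n) (hα : 0 < α) (hind : iIndepFun p P)
    (hlaw : ∀ j, HasLaw (p j) (dirichletMeasure fun _ : Fin n => α) P)
    (hmed : IsUniqueMedian (P.map fun ω => weightedMean θ (p 0 ω)) m) (hm : ∀ i, m ≠ θ i) :
    ∃ f : ℝ → ℝ,
      IsDensityOf f (P.map fun ω => weightedMean θ (p 0 ω)) ∧
      ContDiffAt ℝ 3 f m ∧ 0 < f m ∧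
      FirstOrderBiasVariance P (medianEstimator fun j ω => weightedMean θ (p j ω)) m ∧
      SecondOrderBiasVariance P (medianEstimator fun j ω => weightedMean θ (p j ω)) f m := by
  have hwm := measurable_weightedMean θ
  have hmap : ∀ j, P.map (fun ω => weightedMean θ (p j ω)) = dirichletMeanLaw α θ := fun j => by
    rw [dirichletMeanLaw, ← (hlaw j).map_eq,
      AEMeasurable.map_map_of_aemeasurable hwm.aemeasurable (hlaw j).aemeasurable]
    rfl
  have hae : ∀ j, AEMeasurable (fun ω => weightedMean θ (p j ω)) P := fun j =>
    hwm.comp_aemeasurable (hlaw j).aemeasurable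
  have hY : iIndepFun (fun j ω => weightedMean θ (p j ω)) P := hind.comp _ fun _ => hwm
  have hid : ∀ j, IdentDistrib (fun ω => weightedMean θ (p j ω))
      (fun ω => weightedMean θ (p 0 ω)) P P := fun j => ⟨hae j, hae 0, by rw [hmap, hmap]⟩
  have hprob := isProbabilityMeasure_dirichletMeanLaw hα θ
  have hmed' := hmed
  rw [hmap] at hmed'
  have hnull := nullSingletonClass_dirichletMeanLaw hn hα
    (exists_ne_of_isUniqueMedian hn hα hmed' hm)
  have hcdf := hmed'.1.cdf_eq
  have hm' : ∀ i, θ i ≠ m := fun i => (hm i).symm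
  have hf : IsDensityOf (deriv (cdf (dirichletMeanLaw α θ)))
      (P.map fun ω => weightedMean θ (p 0 ω)) := by
    rw [hmap]
    refine isDensityOf_deriv_cdf (Set.finite_range θ) fun x hx => ?_
    exact (analyticAt_cdf_dirichletMeanLaw hn hα fun i h => hx ⟨i, h⟩).differentiableAt
  have hsmooth : ContDiffAt ℝ 3 (deriv (cdf (dirichletMeanLaw α θ))) m :=
    (analyticAt_cdf_dirichletMeanLaw hn hα hm').deriv.contDiffAt
  -- Positivity needs `0 < F m < 1`, and here `F m = 1/2`.
  have hpos : 0 < deriv (cdf (dirichletMeanLaw α θ)) m :=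
    deriv_cdf_dirichletMeanLaw_pos hn hα (by rw [hcdf]; norm_num) (by rw [hcdf]; norm_num) hm'
  have h2 : MemLp (fun ω => weightedMean θ (p 0 ω)) 2 P := by
    have h := memLp_id_dirichletMeanLaw hn hα θ
    rw [← hmap 0] at h
    exact (memLp_map_measure_iff aestronglyMeasurable_id (hae 0)).1 h
  exact ⟨_, hf, hsmooth, hpos,
    firstOrderBiasVariance_medianEstimator hY hid h2 hmed.1 hf hpos
      (hsmooth.differentiableAt (by norm_num)),
    secondOrderBiasVariance_medianEstimator hY hid h2 hmed.1 hf hpos hsmooth⟩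

theorem mainTheorem9 {Ω : Type*} [MeasurableSpace Ω] (P : Measure Ω) [IsProbabilityMeasure P] :
    -- iid variables of finite variance, with a density that is positive and regular at the median
    (∀ (Y : ℕ → Ω → ℝ) (f : ℝ → ℝ) (m : ℝ),
      iIndepFun Y P →
      (∀ j, IdentDistrib (Y j) (Y 0) P P) →
      MemLp (Y 0) 2 P →
      IsUniqueMedian (P.map (Y 0)) m →
      IsDensityOf f (P.map (Y 0)) →
      0 < f m →
      (DifferentiableAt ℝ f m → FirstOrderBiasVariance P (medianEstimator Y) m) ∧
      (ContDiffAt ℝ 3 f m → SecondOrderBiasVariance P (medianEstimator Y) f m)) ∧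
    -- the Bayesian median of means: Dirichlet means of fixed estimates
    (∀ (n : ℕ) (α : ℝ) (θ : Fin n → ℝ) (p : ℕ → Ω → Fin n → ℝ) (m : ℝ),
      0 < n → 0 < α →
      iIndepFun p P →
      (∀ j, HasLaw (p j) (dirichletMeasure fun _ : Fin n => α) P) →
      IsUniqueMedian (P.map fun ω => weightedMean θ (p 0 ω)) m →
      (∀ i, m ≠ θ i) →
      ∃ f : ℝ → ℝ,
        IsDensityOf f (P.map fun ω => weightedMean θ (p 0 ω)) ∧
        ContDiffAt ℝ 3 f m ∧ 0 < f m ∧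
        FirstOrderBiasVariance P (medianEstimator fun j ω => weightedMean θ (p j ω)) m ∧
        SecondOrderBiasVariance P (medianEstimator fun j ω => weightedMean θ (p j ω)) f m) := by
  refine ⟨fun Y f m hY hid h2 hm hf hpos => ⟨fun hd => ?_, fun hd => ?_⟩,
    fun n α θ p m hn hα hind hlaw hmed hm =>
      bayesianMedianOfMeans_biasVariance hn hα hind hlaw hmed hm⟩
  · exact firstOrderBiasVariance_medianEstimator hY hid h2 hm.1 hf hpos hd
  · exact secondOrderBiasVariance_medianEstimator hY hid h2 hm.1 hf hpos hd
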